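/- Let $V$ be a Euclidean space of finite dimension $N$, $L\subset V$ a lattice of full rank, $T^N=V/L$ the torus with the quotient metric, and $E_\parallel\subset V$ a linear subspace that is contained in no proper rational subspace of $V$ (a subspace is rational if it is spanned by vectors of $L$). Let $E_\perp$ be the orthogonal complement of $E_\parallel$. Let $S\subset V$ be an arrangement of polyhedral atomic surfaces: $S$ is the union of the $L$-translates of finitely many compact convex polytopes, each contained in an affine subspace parallel to $E_\perp$; $S$ is the closure of its interior relative to the affine subspaces parallel to $E_\perp$; and the vectors $v$ with $S+v=S$ are exactly those of $L$. Let $\partial S$ be the boundary of $S$ relative to the affine subspaces parallel to $E_\perp$. Assume moreover the following consequence of the matching rules: whenever a cut $x+E_\parallel$ meets a (closed) face of $\partial S$, it meets the relative interior of some face parallel to it. For a cut $x+E_\parallel$ the pattern is $P_x=\{v\in E_\parallel : x+v\in S\}$; the cut is non-singular if $(x+E_\parallel)\cap\partial S=\emptyset$. For $A\subset E_\parallel$ and $\rho>0$ let $A[\rho]=(A\cap B(\rho))\cup\partial B(\rho)$, where $B(\rho)$ is the closed Euclidean ball of radius $\rho$ around $0$ in $E_\parallel$, and let $d_H$ be the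 Hausdorff distance. The continuous hull $MP$ is the completion of the set of patterns of non-singular cuts in the metric of approximate match $$D(A,A')=\inf\{1/(\rho+1) : \rho>0,\ d_H(A[\rho],A'[\rho])<1/\rho\}.$$ Fix any norm $\nu$ on $E_\parallel$, and for real $r$ let $Y_r\subset T^N$ be the image of $\partial S+\{v\in E_\parallel : \nu(v)\le r\}$. Let $X_r$ be the completion of $T^N\setminus Y_r$ in its inner metric, in which the distance of two points is the infimum of the lengths of the paths in $T^N\setminus Y_r$ that connect them. Let $(r_n)$ be an unbounded non-decreasing sequence of reals. The inclusions $T^N\setminus Y_{r_{n+1}}\to T^N\setminus Y_{r_n}$ do not increase inner distances and extend to maps $\iota_n:X_{r_{n+1}}\to X_{r_n}$. Then the inverse limit $X=\varprojlim X_{r_n}$ of the maps $\iota_n$ is homeomorphic to $MP$. -/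

import Mathlib

open Set Filter Topology
open scoped ENNReal Pointwise RealInnerProductSpace

noncomputable section

namespace CutProject

/-! ### Cut-and-project data

The ambient Euclidean space is `V`, with a full lattice `L` (so `V ⧸ L` is the flat torus `T^N`, with
the quotient metric), the physical space is `E`, and the orthogonal space is `Eᗮ`. An arrangement of
atomic surfaces is an `L`-periodic set `S ⊆ V`. -/

section Geometry

variable {V : Type*} [NormedAddCommGroup V] [InnerProductSpace ℝ V]

/-- A real subspace is rational if it is spanned by the lattice vectors that it contains. -/
def IsRational (L : Submodule ℤ V) (W : Submodule ℝ V) : Prop :=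
  Submodule.span ℝ ((W : Set V) ∩ (L : Set V)) = W

/-- The physical space is contained in no proper rational subspace. -/
def IsTotallyIrrational (L : Submodule ℤ V) (E : Submodule ℝ V) : Prop :=
  ∀ W : Submodule ℝ V, IsRational L W → E ≤ W → W = ⊤

/-- The interior of `S` along the affine subspaces parallel to `Eᗮ`. -/
def perpInterior (E : Submodule ℝ V) (S : Set V) : Set V :=
  {x | x ∈ S ∧ ∀ᶠ y in 𝓝 x, y - x ∈ Eᗮ → y ∈ S}

/-- The boundary `∂S` of `S` as a subset of the affine subspaces parallel to `Eᗮ`. -/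
def perpBoundary (E : Submodule ℝ V) (S : Set V) : Set V :=
  S \ perpInterior E S

/-- `S` is the periodic arrangement of flat polyhedral atomic surfaces parallel to `Eᗮ`: a union of
the lattice translates of finitely many polytopes, each of them contained in an affine subspace
parallel to `Eᗮ`, of pure dimension `dim Eᗮ`, and such that the lattice is exactly the group of
periods of the arrangement. -/
structure IsAtomicSurface (L : Submodule ℤ V) (E : Submodule ℝ V) (S : Set V) : Prop where
  /-- finitely many polytopes modulo the lattice, parallel to `Eᗮ` -/
  polyhedral : ∃ F : Finset (Finset V),
    (∀ t ∈ F, ∀ a ∈ t, ∀ b ∈ t, a - b ∈ Eᗮ) ∧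
    S = ⋃ l ∈ L, ⋃ t ∈ F, (fun x => x + l) '' convexHull ℝ (t : Set V)
  /-- there are no parts of lower dimension -/
  pure : S ⊆ closure (perpInterior E S)
  /-- the periods of the arrangement are exactly the lattice vectors -/
  periods : ∀ v : V, (∀ x, x + v ∈ S ↔ x ∈ S) ↔ v ∈ L

/-- `x` is in the relative interior of a face of `S` with outward normal `k`: within the affine
subspace `x + Eᗮ`, the set `S` is near `x` the half-space `⟪k, y - x⟫ ≤ 0`. -/
def IsFacePoint (E : Submodule ℝ V) (S : Set V) (k x : V) : Prop :=
  ∀ᶠ y in 𝓝 x, y - x ∈ Eᗮ → (y ∈ S ↔ ⟪k, y - x⟫ ≤ 0)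

/-- The union of the relative interiors of the faces of `S` with normal `± k`. -/
def faceInteriors (E : Submodule ℝ V) (S : Set V) (k : V) : Set V :=
  {x | IsFacePoint E S k x ∨ IsFacePoint E S (-k) x}

/-- The condition on the faces that the result needs from the matching rules: a cut that meets a
closed face crosses, at one point at least, the relative interior of a face parallel to it. (Matching
rules make it cross the face along a relatively dense subset of a hyperplane of the cut.) The closed
faces with normal `± k` make up the closure of `faceInteriors E S k`. -/
def FacesAreCrossed (E : Submodule ℝ V) (S : Set V) : Prop :=
  ∀ k ∈ Eᗮ, k ≠ 0 → ∀ x ∈ closure (faceInteriors E S k), ∃ v ∈ E, x + v ∈ faceInteriors E S k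

/-- The obstacles `Y_r = ∂S + B_r` in the torus, where `B_r` is the closed ball of radius `r` in `E`
for the norm `ν` of `E`. -/
def obstacle (L : Submodule ℤ V) (E : Submodule ℝ V) (S : Set V) (ν : Seminorm ℝ E) (r : ℝ) :
    Set (V ⧸ L) :=
  {z | ∃ x ∈ perpBoundary E S, ∃ v : E, ν v ≤ r ∧ z = Submodule.Quotient.mk (x + (v : V))}

theorem obstacle_mono (L : Submodule ℤ V) (E : Submodule ℝ V) (S : Set V) (ν : Seminorm ℝ E)
    {r s : ℝ} (h : r ≤ s) : obstacle L E S ν r ⊆ obstacle L E S ν s := by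
  rintro z ⟨x, hx, v, hv, rfl⟩
  exact ⟨x, hx, v, hv.trans h, rfl⟩

end Geometry

/-! ### The inner metric on the complement of a set -/

section InnerMetric

variable {T : Type*} [PseudoEMetricSpace T]

/-- The infimum of the lengths of the continuous paths from `x` to `y` that avoid `Y`. -/
def innerEDist (Y : Set T) (x y : T) : ℝ≥0∞ :=
  ⨅ (γ : ℝ → T) (a : ℝ) (b : ℝ) (_ : a ≤ b ∧ ContinuousOn γ (Icc a b) ∧ γ a = x ∧ γ b = y ∧
    ∀ t ∈ Icc a b, γ t ∉ Y), eVariationOn γ (Icc a b)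

theorem innerEDist_le {Y : Set T} {x y : T} {γ : ℝ → T} {a b : ℝ} (hab : a ≤ b)
    (hc : ContinuousOn γ (Icc a b)) (ha : γ a = x) (hb : γ b = y) (hY : ∀ t ∈ Icc a b, γ t ∉ Y) :
    innerEDist Y x y ≤ eVariationOn γ (Icc a b) :=
  iInf_le_of_le γ <| iInf_le_of_le a <| iInf_le_of_le b <| iInf_le _ ⟨hab, hc, ha, hb, hY⟩

theorem innerEDist_self {Y : Set T} {x : T} (hx : x ∉ Y) : innerEDist Y x x = 0 := by
  refine le_antisymm ?_ zero_le
  refine (innerEDist_le (γ := fun _ => x) (a := 0) (b := 0) le_rfl continuousOn_const rfl rfl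
    (fun _ _ => hx)).trans ?_
  rw [eVariationOn.subsingleton _ (by simp)]

theorem innerEDist_comm_le (Y : Set T) (x y : T) : innerEDist Y x y ≤ innerEDist Y y x := by
  refine le_iInf fun γ => le_iInf fun a => le_iInf fun b => le_iInf fun h => ?_
  obtain ⟨hab, hc, ha, hb, hY⟩ := h
  have hm : MapsTo (fun t : ℝ => -t) (Icc (-b) (-a)) (Icc a b) := by
    intro t ht
    exact ⟨by linarith [ht.2], by linarith [ht.1]⟩
  refine (innerEDist_le (γ := γ ∘ fun t => -t) (a := -b) (b := -a) (by linarith)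
    (hc.comp continuous_neg.continuousOn hm) (by simp [hb]) (by simp [ha])
    (fun t ht => hY _ (hm ht))).trans ?_
  exact eVariationOn.comp_le_of_antitoneOn γ _ (fun s _ t _ h => neg_le_neg h) hm

theorem innerEDist_triangle (Y : Set T) (x y z : T) :
    innerEDist Y x z ≤ innerEDist Y x y + innerEDist Y y z := by
  conv_rhs => unfold innerEDist
  simp only [ENNReal.iInf_add, ENNReal.add_iInf]
  refine le_iInf fun δ => le_iInf fun c => le_iInf fun d => le_iInf fun h' =>
    le_iInf fun γ => le_iInf fun a => le_iInf fun b => le_iInf fun h => ?_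
  obtain ⟨hab, hγ, ha, hb, hY⟩ := h
  obtain ⟨hcd, hδ, hc, hd, hY'⟩ := h'
  have hm : MapsTo (fun t : ℝ => t - b + c) (Icc b (b + (d - c))) (Icc c d) := by
    intro t ht
    exact ⟨by linarith [ht.1], by linarith [ht.2]⟩
  let η : ℝ → T := fun t => if t ≤ b then γ t else δ (t - b + c)
  have h1 : EqOn η γ (Icc a b) := fun t ht => if_pos ht.2
  have h2 : EqOn η (δ ∘ fun t => t - b + c) (Icc b (b + (d - c))) := by
    intro t ht
    rcases eq_or_lt_of_le ht.1 with rfl | hlt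
    · simp [η, hb, hc]
    · simp [η, not_le.2 hlt]
  have hbd : b ≤ b + (d - c) := by linarith
  have hun : Icc a (b + (d - c)) = Icc a b ∪ Icc b (b + (d - c)) :=
    (Icc_union_Icc_eq_Icc hab hbd).symm
  have hη : ContinuousOn η (Icc a (b + (d - c))) := by
    rw [hun]
    refine ContinuousOn.union_of_isClosed (hγ.congr h1) (ContinuousOn.congr ?_ h2) isClosed_Icc
      isClosed_Icc
    exact hδ.comp (by fun_prop) hm
  have hηa : η a = x := by rw [h1 ⟨le_rfl, hab⟩, ha]
  have hηd : η (b + (d - c)) = z := by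
    rw [h2 ⟨hbd, le_rfl⟩]
    simp [hd]
  have hηY : ∀ t ∈ Icc a (b + (d - c)), η t ∉ Y := by
    intro t ht
    rw [hun] at ht
    rcases ht with ht | ht
    · rw [h1 ht]
      exact hY t ht
    · rw [h2 ht]
      exact hY' _ (hm ht)
  refine (innerEDist_le (hab.trans hbd) hη hηa hηd hηY).trans ?_
  have hsum := eVariationOn.Icc_add_Icc η (s := univ) hab hbd (mem_univ b)
  simp only [univ_inter] at hsum
  rw [← hsum, eVariationOn.congr h1, eVariationOn.congr h2]
  gcongr
  exact eVariationOn.comp_le_of_monotoneOn δ _ (fun s _ t _ h => by simpa using h) hm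

/-- The complement of `Y`, to be equipped with the inner metric (not with the induced metric). -/
def Complement (Y : Set T) : Type _ := {x : T // x ∉ Y}

instance (Y : Set T) : PseudoEMetricSpace (Complement Y) where
  edist x y := innerEDist Y x.1 y.1
  edist_self x := innerEDist_self x.2
  edist_comm x y := le_antisymm (innerEDist_comm_le Y x.1 y.1) (innerEDist_comm_le Y y.1 x.1)
  edist_triangle x y z := innerEDist_triangle Y x.1 y.1 z.1

/-- The inclusion of complements. -/
def Complement.incl {Y Z : Set T} (h : Y ⊆ Z) (x : Complement Z) : Complement Y :=
  ⟨x.1, fun hx => x.2 (h hx)⟩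

/-- The inclusions do not increase the inner distance, so they extend to the completions. -/
theorem Complement.lipschitz_incl {Y Z : Set T} (h : Y ⊆ Z) :
    LipschitzWith 1 (Complement.incl h) := by
  intro x y
  rw [ENNReal.coe_one, one_mul]
  refine le_iInf fun γ => le_iInf fun a => le_iInf fun b => le_iInf fun hγ => ?_
  obtain ⟨hab, hc, ha, hb, hZ⟩ := hγ
  exact innerEDist_le hab hc ha hb fun t ht hY => hZ t ht (h hY)

end InnerMetric

/-! ### The metric of approximate match -/

section Match

variable {E : Type*} [NormedAddCommGroup E]

/-- The patch of `A` in the closed ball of radius `r`, with the sphere of radius `r` added. -/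
def patch (A : Set E) (r : ℝ) : Set E :=
  (A ∩ Metric.closedBall 0 r) ∪ Metric.sphere 0 r

/-- The distance of approximate match: the infimum of `1 / (r + 1)` over the radii `r > 0` for which
the Hausdorff distance of the patches of radius `r` is less than `1 / r`. -/
def matchEDist (A B : Set E) : ℝ≥0∞ :=
  ⨅ (r : ℝ) (_ : 0 < r ∧
    Metric.hausdorffEDist (patch A r) (patch B r) < ENNReal.ofReal (1 / r)),
    ENNReal.ofReal (1 / (r + 1))

theorem patch_hausdorff_le [NormedSpace ℝ E] {A B : Set E} {t r : ℝ} (htr : t ≤ r)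
    {ε : ℝ≥0∞} (h : Metric.hausdorffEDist (patch A r) (patch B r) < ε) :
    Metric.hausdorffEDist (patch A t) (patch B t) ≤ ε := by
  have key : ∀ {A B : Set E}, Metric.hausdorffEDist (patch A r) (patch B r) < ε →
      ∀ x ∈ patch A t, ∃ y ∈ patch B t, edist x y ≤ ε := by
    intro A B h x hx
    rcases hx with ⟨hxA, hxt⟩ | hx
    · have hxr : x ∈ patch A r := Or.inl ⟨hxA, Metric.closedBall_subset_closedBall htr hxt⟩
      obtain ⟨y, hy, hxy⟩ := Metric.exists_edist_lt_of_hausdorffEDist_lt hxr h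
      by_cases hyt : ‖y‖ ≤ t
      · have hyB : y ∈ B ∨ ‖y‖ = t := by
          rcases hy with hy | hy
          · exact Or.inl hy.1
          · right
            have : ‖y‖ = r := by simpa using hy
            exact le_antisymm hyt (this ▸ htr)
        refine ⟨y, ?_, hxy.le⟩
        rcases hyB with hyB | hyB
        · exact Or.inl ⟨hyB, by simpa using hyt⟩
        · exact Or.inr (by simpa using hyB)
      · have hxt' : ‖x‖ ≤ t := by simpa using hxt
        have hcont : ContinuousOn (fun s : ℝ => ‖x + s • (y - x)‖) (Icc 0 1) := by fun_prop
        obtain ⟨s, hs, hst⟩ := intermediate_value_Icc zero_le_one hcont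
          (show t ∈ Icc _ _ by simpa using ⟨hxt', (not_le.1 hyt).le⟩)
        refine ⟨x + s • (y - x), Or.inr (by simpa using hst), le_trans ?_ hxy.le⟩
        rw [edist_dist, edist_dist]
        apply ENNReal.ofReal_le_ofReal
        rw [dist_eq_norm, dist_eq_norm, norm_sub_rev x y, sub_add_cancel_left, norm_neg, norm_smul,
          Real.norm_of_nonneg hs.1]
        exact mul_le_of_le_one_left (norm_nonneg _) hs.2
    · exact ⟨x, Or.inr hx, by simp⟩
  refine Metric.hausdorffEDist_le_of_mem_edist (key h) fun x hx => ?_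
  exact key (by rwa [Metric.hausdorffEDist_comm]) x hx

theorem matchEDist_self (A : Set E) : matchEDist A A = 0 := by
  refine le_antisymm (ENNReal.le_of_forall_pos_le_add fun ε hε _ => ?_) zero_le
  have hε' : (0 : ℝ) < ε := hε
  refine (iInf₂_le (1 / (ε : ℝ)) ⟨by positivity, by simpa [Metric.hausdorffEDist_self] using hε⟩).trans ?_
  rw [zero_add, ← ENNReal.ofReal_coe_nnreal]
  apply ENNReal.ofReal_le_ofReal
  rw [div_le_iff₀ (by positivity)]
  field_simp
  linarith

theorem matchEDist_comm (A B : Set E) : matchEDist A B = matchEDist B A := by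
  simp only [matchEDist, Metric.hausdorffEDist_comm]

theorem matchEDist_triangle [NormedSpace ℝ E] (A B C : Set E) :
    matchEDist A C ≤ matchEDist A B + matchEDist B C := by
  conv_rhs => unfold matchEDist
  simp only [ENNReal.iInf_add, ENNReal.add_iInf]
  refine le_iInf fun s => le_iInf fun hs => le_iInf fun r => le_iInf fun hr => ?_
  obtain ⟨hr, hAB⟩ := hr
  obtain ⟨hs, hBC⟩ := hs
  have htr : r * s / (r + s) ≤ r := by
    rw [div_le_iff₀ (by positivity)]
    nlinarith
  have hts : r * s / (r + s) ≤ s := by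
    rw [div_le_iff₀ (by positivity)]
    nlinarith
  obtain ⟨ε, hABε, hε⟩ := exists_between hAB
  obtain ⟨δ, hBCδ, hδ⟩ := exists_between hBC
  refine (iInf₂_le (r * s / (r + s)) ⟨by positivity, ?_⟩).trans ?_
  rotate_left
  · calc _ ≤ _ := Metric.hausdorffEDist_triangle (t := patch B (r * s / (r + s)))
      _ ≤ ε + δ := add_le_add (patch_hausdorff_le htr hABε) (patch_hausdorff_le hts hBCδ)
      _ < ENNReal.ofReal (1 / r) + ENNReal.ofReal (1 / s) := ENNReal.add_lt_add hε hδ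
      _ = ENNReal.ofReal (1 / (r * s / (r + s))) := by
        rw [← ENNReal.ofReal_add (by positivity) (by positivity)]
        congr 1
        field_simp
        ring
  · rw [← ENNReal.ofReal_add (by positivity) (by positivity)]
    apply ENNReal.ofReal_le_ofReal
    have h1 : 1 / (r * s / (r + s) + 1) = (r + s) / (r * s + r + s) := by
      field_simp
      ring
    have h2 : 1 / (r + 1) + 1 / (s + 1) = (r + s + 2) / (r * s + r + s + 1) := by
      field_simp
      ring
    rw [h1, h2, div_le_div_iff₀ (by positivity) (by positivity)]
    nlinarith [mul_pos hr hs]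

end Match

/-! ### The hull and the inverse limit -/

section Hull

variable {V : Type*} [NormedAddCommGroup V] [InnerProductSpace ℝ V]

/-- The pattern produced by the cut through `x`. -/
def pattern (E : Submodule ℝ V) (S : Set V) (x : V) : Set E :=
  {v | x + (v : V) ∈ S}

/-- The cut `x + E` is non-singular if it does not meet the boundary of the atomic surfaces. -/
def IsNonsingular (E : Submodule ℝ V) (S : Set V) (x : V) : Prop :=
  ∀ v : E, x + (v : V) ∉ perpBoundary E S

/-- The space of the patterns produced by the non-singular cuts. -/
def Pattern (E : Submodule ℝ V) (S : Set V) : Type _ :=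
  {A : Set E // ∃ x, IsNonsingular E S x ∧ A = pattern E S x}

instance (E : Submodule ℝ V) (S : Set V) : PseudoEMetricSpace (Pattern E S) where
  edist A B := matchEDist A.1 B.1
  edist_self A := matchEDist_self A.1
  edist_comm A B := matchEDist_comm A.1 B.1
  edist_triangle A B C := matchEDist_triangle A.1 B.1 C.1

/-- The continuous hull `MP`: the completion of the space of non-singular patterns for the metric of
approximate match. -/
abbrev Hull (E : Submodule ℝ V) (S : Set V) : Type _ :=
  UniformSpace.Completion (Pattern E S)

/-- The space `X_r`: the metric completion of the complement of the obstacles for its inner metric. -/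
abbrev CompletedComplement (L : Submodule ℤ V) (E : Submodule ℝ V) (S : Set V) (ν : Seminorm ℝ E)
    (r : ℝ) : Type _ :=
  UniformSpace.Completion (Complement (obstacle L E S ν r))

/-- The map `X_s → X_r`, for `r ≤ s`, that extends the inclusion of the complements. -/
def transition (L : Submodule ℤ V) (E : Submodule ℝ V) (S : Set V) (ν : Seminorm ℝ E) {r s : ℝ}
    (h : r ≤ s) : CompletedComplement L E S ν s → CompletedComplement L E S ν r :=
  UniformSpace.Completion.map (Complement.incl (obstacle_mono L E S ν h))

/-- The inverse limit of the sequence of the spaces `X_{r n}`, with the topology induced by the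
product topology. -/
abbrev InverseLimit (L : Submodule ℤ V) (E : Submodule ℝ V) (S : Set V) (ν : Seminorm ℝ E)
    {r : ℕ → ℝ} (hr : Monotone r) : Type _ :=
  {x : ∀ n, CompletedComplement L E S ν (r n) //
    ∀ n, transition L E S ν (hr n.le_succ) (x (n + 1)) = x n}

end Hull

end CutProject

end

/-! Both spaces are completions of one set: the set of points `x` of `V` whose cut is non-singular.
Such a point has a pattern in the hull, and it has a class in every complement, hence a point of the
inverse limit. Both maps have dense range, so it suffices that they pull back the same uniformity
(`nonempty_homeomorph_of_comap_uniformity_eq`). Below, a flat is an affine subspace parallel to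
`Eᗮ`.

Close in the inner metric implies close patterns (`exists_matchEDist_lt`). A short path off the
obstacle `Y_r` lifts to `V`. If `x + v` is in `S`, let it follow the component of the lifted path
along `Eᗮ`. It stays in one flat and never meets `∂S`, so it stays in `S`. Thus pattern points move
by small vectors, at all radii that the `ν`-ball of radius `r` covers; unboundedness of the radii
gives all radii.

Close patterns imply close in the inner metric (`exists_innerEDist_lt`). Otherwise there are bounded
sequences `x n`, `y n` with better and better matching patterns but inner distance bounded below.
Their limits along an ultrafilter differ by a period of `S`, because `E + L` is dense by total
irrationality; so they differ by a lattice vector, and may be taken equal. Now join `x n` to `y n`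
first along `Eᗮ`, then along `E`. The second piece stays in the non-singular cut of `y n`. If the
first piece met the obstacle, there would be boundary points converging within one closed face. By
the crossing condition, the limit can be moved along `E` into the interior of a parallel face, where
`S` is a half-space of the flat. Moved likewise, the cuts of `x n` and `y n` hit this flat on
opposite sides of the face, while matching within a flat is exact: one is in `S` if and only if the
other is. One of them must then lie on the face, against non-singularity
(`AsymptoticMatch.eventually_notMem_perpBoundary`).

The polyhedral input is that `∂S` is covered by locally finitely many polytopes of positive
codimension in the flats (`exists_isBoundaryCover`), which makes non-singular points dense, and that
every boundary point is in a closed face (`exists_mem_closure_faceInteriors`). -/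

noncomputable section

namespace CutProject

/-! ### Locally finite families of polytopes -/

section Polytopes

variable {V : Type*} [NormedAddCommGroup V] [InnerProductSpace ℝ V]

/-- A family of finite sets of vertices whose convex hulls form a locally finite family. -/
def LocallyFiniteHulls (T : Set (Finset V)) : Prop :=
  ∀ R : ℝ, {t ∈ T | (convexHull ℝ (t : Set V) ∩ Metric.closedBall 0 R).Nonempty}.Finite

theorem isClosed_convexHull_finset (t : Finset V) : IsClosed (convexHull ℝ (t : Set V)) :=
  (t.finite_toSet.isCompact_convexHull (𝕜 := ℝ)).isClosed

/-- Only finitely many hulls come near `w`, and those that miss `w` are closed, so a small ball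
avoids them all. -/
theorem LocallyFiniteHulls.eventually_mem {T : Set (Finset V)} (hT : LocallyFiniteHulls T) (w : V) :
    ∀ᶠ y in 𝓝 w, ∀ t ∈ T, y ∈ convexHull ℝ (t : Set V) → w ∈ convexHull ℝ (t : Set V) := by
  have hfin := hT (‖w‖ + 1)
  have h1 : ∀ᶠ y in 𝓝 w, ∀ t ∈ {t ∈ T | (convexHull ℝ (t : Set V) ∩
      Metric.closedBall 0 (‖w‖ + 1)).Nonempty},
      y ∈ convexHull ℝ (t : Set V) → w ∈ convexHull ℝ (t : Set V) := by
    refine (hfin.eventually_all).2 fun t _ => ?_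
    by_cases hw : w ∈ convexHull ℝ (t : Set V)
    · exact Eventually.of_forall fun _ _ => hw
    · filter_upwards [(isClosed_convexHull_finset t).isOpen_compl.mem_nhds hw] with y hy hy'
      exact absurd hy' hy
  filter_upwards [h1, Metric.ball_mem_nhds w one_pos] with y hy hyw t ht hyt
  refine hy t ⟨ht, y, hyt, ?_⟩ hyt
  rw [mem_closedBall_zero_iff]
  have := norm_add_le w (y - w)
  rw [add_sub_cancel] at this
  rw [Metric.mem_ball, dist_eq_norm] at hyw
  linarith

theorem LocallyFiniteHulls.countable {T : Set (Finset V)} (hT : LocallyFiniteHulls T)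
    (hne : ∀ t ∈ T, t.Nonempty) : T.Countable := by
  refine (countable_iUnion fun n : ℕ => (hT n).countable).mono fun t ht => ?_
  obtain ⟨a, ha⟩ := hne t ht
  obtain ⟨n, hn⟩ := exists_nat_ge ‖a‖
  exact mem_iUnion.2 ⟨n, ht, a, subset_convexHull ℝ _ ha, by simpa using hn⟩

theorem sub_mem_vectorSpan_of_mem_convexHull {t : Set V} {x y : V} (hx : x ∈ convexHull ℝ t)
    (hy : y ∈ convexHull ℝ t) : x - y ∈ vectorSpan ℝ t := by
  rw [← direction_affineSpan]
  exact AffineSubspace.vsub_mem_direction (convexHull_subset_affineSpan t hx)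
    (convexHull_subset_affineSpan t hy)

theorem vectorSpan_le_of_sub_mem {t : Set V} {W : Submodule ℝ V}
    (h : ∀ a ∈ t, ∀ b ∈ t, a - b ∈ W) : vectorSpan ℝ t ≤ W := by
  rw [vectorSpan_def, Submodule.span_le]
  rintro _ ⟨a, ha, b, hb, rfl⟩
  exact h a ha b hb

/-- A convex combination of finitely many points with positive weights is interior to their convex
hull in the affine space that they span. -/
theorem eventually_mem_convexHull_of_pos [FiniteDimensional ℝ V] (s : Finset V) (w : V → ℝ)
    (hw : ∀ a ∈ s, 0 < w a) (h1 : ∑ a ∈ s, w a = 1) :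
    ∀ᶠ y in 𝓝 (∑ a ∈ s, w a • a), y - ∑ a ∈ s, w a • a ∈ vectorSpan ℝ (s : Set V) →
      y ∈ convexHull ℝ (s : Set V) := by
  set p := ∑ a ∈ s, w a • a with hp
  let f : (V → ℝ) →ₗ[ℝ] V := ∑ a ∈ s, (LinearMap.proj a).smulRight a
  have hf : ∀ c : V → ℝ, f c = ∑ a ∈ s, c a • a := fun c => by simp [f]
  let σ : (V → ℝ) →ₗ[ℝ] ℝ := ∑ a ∈ s, LinearMap.proj a
  have hσ : ∀ c : V → ℝ, σ c = ∑ a ∈ s, c a := fun c => by simp [σ]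
  let W := vectorSpan ℝ (s : Set V)
  have hle : W ≤ (LinearMap.ker σ).map f := by
    classical
    refine vectorSpan_le_of_sub_mem fun a ha b hb => ?_
    refine ⟨Pi.single a 1 - Pi.single b 1, ?_, ?_⟩
    · change σ _ = 0
      rw [hσ]
      simp only [Finset.mem_coe] at ha hb
      simp [Pi.single_apply, ha, hb]
    · simp only [Finset.mem_coe] at ha hb
      rw [hf]
      simp [Pi.single_apply, sub_smul, ha, hb]
  -- A linear section `g` of the map from weight vectors of sum zero to displacements. A small
  -- displacement changes the weights by little, so they remain positive.
  let B := Module.finBasis ℝ W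
  have hB : ∀ i, ∃ c : V → ℝ, σ c = 0 ∧ f c = B i := fun i => by
    obtain ⟨c, hc, hc'⟩ := hle (B i).2
    exact ⟨c, hc, hc'⟩
  choose c hc hc' using hB
  let g : W →ₗ[ℝ] (V → ℝ) := B.constr ℝ c
  have hσg : ∀ v, σ (g v) = 0 := by
    intro v
    have : σ ∘ₗ g = 0 := B.ext fun i => by simp [g, hc]
    exact LinearMap.congr_fun this v
  have hfg : ∀ v, f (g v) = v := by
    intro v
    have : f ∘ₗ g = W.subtype := B.ext fun i => by simp [g, hc']
    exact LinearMap.congr_fun this v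
  have hcont : Continuous g := LinearMap.continuous_of_finiteDimensional g
  have hev : ∀ᶠ v in 𝓝 (0 : W), ∀ a ∈ s, 0 < w a + g v a := by
    refine (Finset.eventually_all s).2 fun a ha => ?_
    have : Tendsto (fun v => w a + g v a) (𝓝 0) (𝓝 (w a + g 0 a)) :=
      (continuous_const.add ((continuous_apply a).comp hcont)).tendsto 0
    simp only [map_zero, Pi.zero_apply, add_zero] at this
    exact this.eventually (lt_mem_nhds (hw a ha))
  rw [nhds_subtype_eq_comap, eventually_comap] at hev
  have htend : Tendsto (fun y => y - p) (𝓝 p) (𝓝 ((0 : W) : V)) := by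
    have : Tendsto (fun y => y - p) (𝓝 p) (𝓝 (p - p)) := (continuous_id.sub continuous_const).tendsto p
    simpa using this
  filter_upwards [htend.eventually hev] with y hy hyW
  have hpos := hy ⟨y - p, hyW⟩ rfl
  rw [Finset.mem_convexHull']
  refine ⟨fun a => w a + g ⟨y - p, hyW⟩ a, fun a ha => (hpos a ha).le, ?_, ?_⟩
  · rw [Finset.sum_add_distrib, h1, ← hσ, hσg, add_zero]
  · simp only [add_smul]
    rw [Finset.sum_add_distrib, ← hf (g _), hfg, ← hp]
    simp

/-- A point of the convex hull of a finite set is interior to the convex hull of some subset, in the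
affine space spanned by the subset. -/
theorem exists_subset_eventually_mem_convexHull [FiniteDimensional ℝ V] {t : Finset V} {p : V}
    (hp : p ∈ convexHull ℝ (t : Set V)) : ∃ s ⊆ t, s.Nonempty ∧ p ∈ convexHull ℝ (s : Set V) ∧
      ∀ᶠ y in 𝓝 p, y - p ∈ vectorSpan ℝ (s : Set V) → y ∈ convexHull ℝ (s : Set V) := by
  classical
  obtain ⟨w, hw0, hw1, hwp⟩ := Finset.mem_convexHull'.1 hp
  -- The vertices of nonzero weight span the smallest piece in which the point is interior.
  let s := t.filter fun a => w a ≠ 0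
  have hs : ∀ a ∈ s, 0 < w a := fun a ha =>
    lt_of_le_of_ne (hw0 a (Finset.mem_filter.1 ha).1) (Finset.mem_filter.1 ha).2.symm
  have h1 : ∑ a ∈ s, w a = 1 := by rw [Finset.sum_filter_ne_zero, hw1]
  have h2 : ∑ a ∈ s, w a • a = p := by
    rw [← hwp]
    refine Finset.sum_filter_of_ne fun a _ h => ?_
    contrapose! h
    simp [h]
  refine ⟨s, Finset.filter_subset _ _, ?_, ?_, ?_⟩
  · rw [Finset.nonempty_iff_ne_empty]
    intro h
    simp [h] at h1
  · exact Finset.mem_convexHull'.2 ⟨w, fun a ha => (hs a ha).le, h1, h2⟩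
  · have := eventually_mem_convexHull_of_pos s w hs h1
    rwa [h2] at this

end Polytopes

/-! ### Sets that are locally contained in a single fiber -/

section Fibers

variable {V : Type*} [NormedAddCommGroup V] [InnerProductSpace ℝ V]

theorem tendsto_add_smul_nhdsGT (y k : V) :
    Tendsto (fun a : ℝ => y + a • k) (𝓝[>] 0) (𝓝 y) := by
  have : Tendsto (fun a : ℝ => y + a • k) (𝓝 0) (𝓝 (y + (0 : ℝ) • k)) :=
    (continuous_const.add (continuous_id.smul continuous_const)).tendsto 0
  simp only [zero_smul, add_zero] at this
  exact this.mono_left nhdsWithin_le_nhds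

/-- `S` is closed, and near each point it is contained in one affine subspace parallel to `Eᗮ`. -/
def IsLocallyFlat (E : Submodule ℝ V) (S : Set V) : Prop :=
  ∀ w, ∀ᶠ y in 𝓝 w, y ∈ S → w ∈ S ∧ y - w ∈ Eᗮ

variable {E : Submodule ℝ V} {S : Set V}

theorem IsLocallyFlat.isClosed (h : IsLocallyFlat E S) : IsClosed S := by
  rw [← isOpen_compl_iff, isOpen_iff_mem_nhds]
  intro w hw
  filter_upwards [h w] with y hy hyS
  exact hw (hy hyS).1

theorem eventually_mem_perpInterior {x : V} (hx : x ∈ perpInterior E S) :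
    ∀ᶠ y in 𝓝 x, y - x ∈ Eᗮ → y ∈ perpInterior E S := by
  filter_upwards [eventually_eventually_nhds.2 hx.2] with y hy hyx
  refine ⟨hy.self_of_nhds hyx, ?_⟩
  filter_upwards [hy] with z hz hzy
  exact hz (by simpa using add_mem hzy hyx)

theorem IsLocallyFlat.isClosed_perpBoundary (h : IsLocallyFlat E S) :
    IsClosed (perpBoundary E S) := by
  rw [← isOpen_compl_iff, isOpen_iff_mem_nhds]
  intro w hw
  by_cases hwS : w ∈ S
  · have hw' : w ∈ perpInterior E S := by
      by_contra hcon
      exact hw ⟨hwS, hcon⟩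
    filter_upwards [h w, eventually_mem_perpInterior hw'] with y hy hy' hyB
    exact hyB.2 (hy' (hy hyB.1).2)
  · filter_upwards [h.isClosed.isOpen_compl.mem_nhds hwS] with y hy hyB
    exact hy hyB.1

/-- Within `A`, the set `S` is closed, and it is open because each of its points there is interior
along the flat. This is how avoiding `∂S` is turned into staying in `S`. -/
theorem subset_of_isPreconnected (hS : IsClosed S) {A : Set V}
    (hA : IsPreconnected A) (hd : ∀ a ∈ A, ∀ b ∈ A, a - b ∈ Eᗮ)
    (hB : ∀ a ∈ A, a ∉ perpBoundary E S) (hne : (A ∩ S).Nonempty) : A ⊆ S := by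
  have : PreconnectedSpace A := isPreconnected_iff_preconnectedSpace.1 hA
  let C : Set A := Subtype.val ⁻¹' S
  have hcl : IsClosed C := hS.preimage continuous_subtype_val
  have hop : IsOpen C := by
    rw [isOpen_iff_mem_nhds]
    intro a ha
    have hi : (a : V) ∈ perpInterior E S := by
      by_contra hcon
      exact hB a a.2 ⟨ha, hcon⟩
    have := continuous_subtype_val.continuousAt (x := a) |>.eventually hi.2
    filter_upwards [this] with b hb
    exact hb (hd b b.2 a a.2)
  obtain ⟨a, haA, haS⟩ := hne
  have hun : C = univ := IsClopen.eq_univ ⟨hcl, hop⟩ ⟨⟨a, haA⟩, haS⟩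
  intro b hb
  have : (⟨b, hb⟩ : A) ∈ C := hun ▸ mem_univ _
  exact this

/-- The points of the hyperplane of a face that are near a point of the interior of the face are
boundary points. -/
theorem IsFacePoint.eventually_mem_perpBoundary {k w : V} (hk : k ∈ Eᗮ) (hk0 : k ≠ 0)
    (h : IsFacePoint E S k w) :
    ∀ᶠ y in 𝓝 w, y - w ∈ Eᗮ → ⟪k, y - w⟫ = 0 → y ∈ perpBoundary E S := by
  filter_upwards [eventually_eventually_nhds.2 h] with y hy hyw hky
  refine ⟨(hy.self_of_nhds hyw).2 hky.le, fun hint => ?_⟩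
  obtain ⟨s, h1, h2, hs⟩ := (((tendsto_add_smul_nhdsGT y k).eventually hy).and
    (((tendsto_add_smul_nhdsGT y k).eventually hint.2).and self_mem_nhdsWithin)).exists
  have hs0 : 0 < s := hs
  have hsk : s • k ∈ Eᗮ := Eᗮ.smul_mem s hk
  have hmem := (h1 (by rw [add_sub_right_comm]; exact add_mem hyw hsk)).1 (h2 (by simpa using hsk))
  rw [add_sub_right_comm, inner_add_right, hky, zero_add, inner_smul_right] at hmem
  have : 0 < ⟪k, k⟫ := real_inner_self_pos.2 hk0
  nlinarith [mul_pos hs0 this]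

end Fibers

/-! ### The boundary of an atomic surface -/

section Boundary

variable {V : Type*} [NormedAddCommGroup V] [InnerProductSpace ℝ V] {E : Submodule ℝ V} {S : Set V}

/-- The boundary of `S` is covered by a locally finite family of polytopes of lower dimension. -/
structure IsBoundaryCover (E : Submodule ℝ V) (S : Set V) (C : Set (Finset V)) : Prop where
  locallyFinite : LocallyFiniteHulls C
  nonempty : ∀ s ∈ C, s.Nonempty
  lt : ∀ s ∈ C, vectorSpan ℝ (s : Set V) < Eᗮ
  cover : ∀ x ∈ perpBoundary E S, ∃ s ∈ C, x ∈ convexHull ℝ (s : Set V)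

theorem finite_lattice_closedBall [FiniteDimensional ℝ V] (L : Submodule ℤ V) [DiscreteTopology L]
    (M : ℝ) : {l | l ∈ L ∧ ‖l‖ ≤ M}.Finite := by
  have : DiscreteTopology L.toAddSubgroup := ‹DiscreteTopology L›
  have hcl : IsClosed (L : Set V) := AddSubgroup.isClosed_of_discrete (H := L.toAddSubgroup)
  have hd : IsDiscrete (L : Set V) := ⟨‹DiscreteTopology L›⟩
  refine (Metric.finite_isBounded_inter_isClosed hd
    (Metric.isBounded_closedBall (x := (0 : V)) (r := M)) hcl).subset ?_
  rintro l ⟨hl, hM⟩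
  exact ⟨by simpa using hM, hl⟩

theorem convexHull_image_add (t : Set V) (l : V) :
    convexHull ℝ ((fun x => x + l) '' t) = (fun x => x + l) '' convexHull ℝ t := by
  have := (AffineEquiv.vaddConst ℝ l).toAffineMap.image_convexHull t
  exact this.symm

theorem locallyFiniteHulls_translates [FiniteDimensional ℝ V] [DecidableEq V] (L : Submodule ℤ V)
    [DiscreteTopology L] (F : Finset (Finset V)) :
    LocallyFiniteHulls {t | ∃ l ∈ L, ∃ t₀ ∈ F, t = t₀.image fun x => x + l} := by
  intro R
  have hb : ∀ t : Finset V, ∃ M : ℝ, ∀ x ∈ convexHull ℝ (t : Set V), ‖x‖ ≤ M := fun t =>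
    (t.finite_toSet.isCompact_convexHull (𝕜 := ℝ)).isBounded.exists_norm_le
  choose M hM using hb
  have hfin : (⋃ t ∈ F, (fun l => t.image fun x => x + l) '' {l | l ∈ L ∧ ‖l‖ ≤ R + M t}).Finite :=
    F.finite_toSet.biUnion fun t _ => (finite_lattice_closedBall L _).image _
  refine hfin.subset ?_
  rintro _ ⟨⟨l, hl, t, ht, rfl⟩, y, hy, hyR⟩
  rw [Finset.coe_image, convexHull_image_add] at hy
  obtain ⟨x, hx, rfl⟩ := hy
  refine mem_iUnion₂.2 ⟨t, ht, l, ⟨hl, ?_⟩, rfl⟩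
  have h1 := hM t x hx
  have h2 : ‖x + l‖ ≤ R := by simpa using hyR
  calc ‖l‖ = ‖(x + l) - x‖ := by simp
    _ ≤ ‖x + l‖ + ‖x‖ := norm_sub_le _ _
    _ ≤ _ := add_le_add h2 h1

theorem IsAtomicSurface.exists_hulls [FiniteDimensional ℝ V] {L : Submodule ℤ V}
    [DiscreteTopology L] (hS : IsAtomicSurface L E S) : ∃ T : Set (Finset V),
      LocallyFiniteHulls T ∧ (∀ t ∈ T, vectorSpan ℝ (t : Set V) ≤ Eᗮ) ∧
      S = ⋃ t ∈ T, convexHull ℝ (t : Set V) := by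
  classical
  obtain ⟨F, hF, hU⟩ := hS.polyhedral
  refine ⟨_, locallyFiniteHulls_translates L F, ?_, ?_⟩
  · rintro _ ⟨l, hl, t, ht, rfl⟩
    refine vectorSpan_le_of_sub_mem ?_
    simp only [Finset.coe_image]
    rintro _ ⟨a, ha, rfl⟩ _ ⟨b, hb, rfl⟩
    simpa using hF t ht a ha b hb
  · rw [hU]
    ext x
    simp only [mem_iUnion, exists_prop, mem_ofPred_eq]
    constructor
    · rintro ⟨l, hl, t, ht, hx⟩
      exact ⟨_, ⟨l, hl, t, ht, rfl⟩, by rwa [Finset.coe_image, convexHull_image_add]⟩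
    · rintro ⟨_, ⟨l, hl, t, ht, rfl⟩, hx⟩
      rw [Finset.coe_image, convexHull_image_add] at hx
      exact ⟨l, hl, t, ht, hx⟩

/-- Near `w` only the polytopes through `w` are seen, and all of these lie in the flat of `w`. -/
theorem IsAtomicSurface.isLocallyFlat [FiniteDimensional ℝ V] {L : Submodule ℤ V}
    [DiscreteTopology L] (hS : IsAtomicSurface L E S) : IsLocallyFlat E S := by
  obtain ⟨T, hT, hd, rfl⟩ := hS.exists_hulls
  intro w
  filter_upwards [hT.eventually_mem w] with y hy hyS
  obtain ⟨t, ht, hyt⟩ := mem_iUnion₂.1 hyS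
  have hw := hy t ht hyt
  exact ⟨mem_iUnion₂.2 ⟨t, ht, hw⟩, hd t ht (sub_mem_vectorSpan_of_mem_convexHull hyt hw)⟩

/-- A point of `S` is interior to the hull of some set of vertices, relative to the span of that
set. If this span were the whole flat, the point would be interior to `S`; so vertex sets of smaller
span cover the boundary. -/
theorem IsAtomicSurface.exists_isBoundaryCover [FiniteDimensional ℝ V] {L : Submodule ℤ V}
    [DiscreteTopology L] (hS : IsAtomicSurface L E S) : ∃ C, IsBoundaryCover E S C := by
  obtain ⟨T, hT, hd, hU⟩ := hS.exists_hulls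
  refine ⟨{s | s.Nonempty ∧ vectorSpan ℝ (s : Set V) < Eᗮ ∧ ∃ t ∈ T, s ⊆ t}, ?_, fun s hs => hs.1,
    fun s hs => hs.2.1, ?_⟩
  · intro R
    refine ((hT R).biUnion (t := fun t => {s | s ∈ t.powerset})
      fun t _ => t.powerset.finite_toSet).subset ?_
    rintro s ⟨⟨-, -, t, ht, hst⟩, y, hy, hyR⟩
    refine mem_iUnion₂.2 ⟨t, ⟨ht, y, convexHull_mono (by exact_mod_cast hst) hy, hyR⟩, ?_⟩
    simpa using hst
  · rintro x ⟨hxS, hx⟩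
    have hxS' := hxS
    rw [hU] at hxS'
    obtain ⟨t, ht, hxt⟩ := mem_iUnion₂.1 hxS'
    obtain ⟨s, hst, hne, hxs, hev⟩ := exists_subset_eventually_mem_convexHull hxt
    refine ⟨s, ⟨hne, ?_, t, ht, hst⟩, hxs⟩
    have hle : vectorSpan ℝ (s : Set V) ≤ Eᗮ :=
      (vectorSpan_mono ℝ (by exact_mod_cast hst)).trans (hd t ht)
    refine lt_of_le_of_ne hle fun heq => hx ⟨hxS, ?_⟩
    filter_upwards [hev] with y hy hyx
    rw [hU]
    exact mem_iUnion₂.2 ⟨t, ht, convexHull_mono (by exact_mod_cast hst) (hy (heq ▸ hyx))⟩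

theorem exists_normal [FiniteDimensional ℝ V] {W F : Submodule ℝ V} (h : W < F) :
    ∃ k ∈ F, k ≠ 0 ∧ ∀ v ∈ W, ⟪k, v⟫ = 0 := by
  by_contra! hcon
  have hbot : Wᗮ ⊓ F = ⊥ := by
    rw [Submodule.eq_bot_iff]
    rintro k ⟨hk, hkF⟩
    by_contra hk0
    obtain ⟨v, hv, hne⟩ := hcon k hkF hk0
    exact hne (Submodule.inner_left_of_mem_orthogonal hv hk)
  have := Submodule.sup_orthogonal_inf_of_hasOrthogonalProjection h.le
  rw [hbot, sup_bot_eq] at this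
  exact h.ne this

/-- Almost every cut is non-singular. -/
theorem IsBoundaryCover.dense_isNonsingular [FiniteDimensional ℝ V] {C : Set (Finset V)}
    (hC : IsBoundaryCover E S C) : Dense {x | IsNonsingular E S x} := by
  have hn : ∀ s : C, ∃ k ∈ Eᗮ, k ≠ 0 ∧ ∃ c : ℝ, ∀ x ∈ convexHull ℝ (s.1 : Set V), ⟪k, x⟫ = c := by
    intro s
    obtain ⟨k, hk, hk0, hkW⟩ := exists_normal (hC.lt s s.2)
    obtain ⟨a, ha⟩ := hC.nonempty s s.2
    refine ⟨k, hk, hk0, ⟪k, a⟫, fun x hx => ?_⟩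
    have := hkW _ (sub_mem_vectorSpan_of_mem_convexHull hx (subset_convexHull ℝ _ ha))
    rwa [inner_sub_right, sub_eq_zero] at this
  choose k hk hk0 c hc using hn
  have : Countable C := (hC.locallyFinite.countable hC.nonempty).to_subtype
  have hcont : ∀ s : C, Continuous fun x => ⟪k s, x⟫ := fun s => by fun_prop
  -- As `k s` is orthogonal to `E`, a cut that meets the polytope `s` lies wholly in one hyperplane.
  -- Baire's theorem avoids the countably many hyperplanes.
  have hdense : Dense (⋂ s : C, {x | ⟪k s, x⟫ ≠ c s}) := by
    refine dense_iInter_of_isOpen (fun s => isOpen_ne_fun (hcont s) continuous_const) fun s => ?_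
    intro x
    by_cases hx : ⟪k s, x⟫ = c s
    · refine mem_closure_of_tendsto (tendsto_add_smul_nhdsGT x (k s)) ?_
      filter_upwards [self_mem_nhdsWithin] with a ha
      have ha' : (0 : ℝ) < a := ha
      have : 0 < ⟪k s, k s⟫ := real_inner_self_pos.2 (hk0 s)
      rw [inner_add_right, hx, inner_smul_right]
      have := mul_pos ha' this
      linarith
    · exact subset_closure hx
  refine hdense.mono fun x hx v hv => ?_
  obtain ⟨s, hs, hxs⟩ := hC.cover _ hv
  refine mem_iInter.1 hx ⟨s, hs⟩ ?_
  rw [← hc ⟨s, hs⟩ _ hxs, inner_add_right,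
    Submodule.inner_left_of_mem_orthogonal v.2 (hk ⟨s, hs⟩), add_zero]

/-- A vector of `F` can be moved slightly out of finitely many subspaces that do not contain `F`. -/
theorem exists_near_notMem [FiniteDimensional ℝ V] {ι : Type*} {I : Set ι} (hI : I.Finite)
    (M : ι → Submodule ℝ V) (F : Submodule ℝ V) (hM : ∀ i ∈ I, ¬ F ≤ M i) {w : V} (hw : w ∈ F)
    {ε : ℝ} (hε : 0 < ε) : ∃ w' ∈ F, ‖w' - w‖ < ε ∧ ∀ i ∈ I, w' ∉ M i := by
  have hdense : Dense (⋂ i ∈ I, {x : F | (x : V) ∉ M i}) := by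
    refine dense_biInter_of_isOpen (fun i _ => ?_) hI.countable fun i hi => ?_
    · exact ((M i).closed_of_finiteDimensional.preimage continuous_subtype_val).isOpen_compl
    · have : {x : F | (x : V) ∉ M i} = ((Submodule.comap F.subtype (M i) : Submodule ℝ F) : Set F)ᶜ := rfl
      rw [this, ← interior_eq_empty_iff_dense_compl, ← not_nonempty_iff_eq_empty]
      intro h
      have := Submodule.eq_top_of_nonempty_interior' _ h
      exact hM i hi (Submodule.comap_subtype_eq_top.1 this)
  obtain ⟨w', hw', h⟩ := Metric.dense_iff.1 hdense ⟨w, hw⟩ ε hε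
  refine ⟨w', w'.2, ?_, fun i hi => mem_iInter₂.1 h i hi⟩
  rw [← dist_eq_norm]
  exact hw'

end Boundary

/-! ### The faces of an atomic surface -/

section Faces

variable {V : Type*} [NormedAddCommGroup V] [InnerProductSpace ℝ V] {E : Submodule ℝ V} {S : Set V}

/-- If the boundary of `S` is, near one of its points, contained in a hyperplane, then the point is
in the interior of a face. -/
theorem mem_faceInteriors_of_eventually (hS : IsLocallyFlat E S) (hp : S ⊆ closure (perpInterior E S))
    {k q : V} (hk : k ∈ Eᗮ) (hk0 : k ≠ 0) (hq : q ∈ perpBoundary E S)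
    (hloc : ∀ᶠ y in 𝓝 q, y ∈ perpBoundary E S → ⟪k, y - q⟫ = 0) : q ∈ faceInteriors E S k := by
  obtain ⟨η, hη, hball⟩ := Metric.eventually_nhds_iff_ball.1 (hloc.and (hS q))
  -- The two open half-balls cut out of the flat by the hyperplane. They are convex and miss `∂S`,
  -- so each is inside `S` or disjoint from it.
  let H : V → Set V := fun k' => {y | y ∈ Metric.ball q η ∧ y - q ∈ Eᗮ ∧ 0 < ⟪k', y - q⟫}
  have hconv : ∀ k', Convex ℝ (H k') := by
    intro k' x hx y hy a b ha hb hab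
    have h1 : a • x + b • y - q = a • (x - q) + b • (y - q) := by
      rw [smul_sub, smul_sub, sub_add_sub_comm, ← add_smul, hab, one_smul]
    refine ⟨convex_ball q η hx.1 hy.1 ha hb hab, ?_, ?_⟩
    · rw [h1]
      exact add_mem (Eᗮ.smul_mem _ hx.2.1) (Eᗮ.smul_mem _ hy.2.1)
    · rw [h1, inner_add_right, inner_smul_right, inner_smul_right]
      rcases eq_or_lt_of_le ha with rfl | ha
      · have : b = 1 := by linarith
        subst this
        simpa using hy.2.2
      · have h2 := mul_pos ha hx.2.2
        have h3 := mul_nonneg hb hy.2.2.le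
        linarith
  have hsub : ∀ k', (k' = k ∨ k' = -k) → (H k' ∩ S).Nonempty → H k' ⊆ S := by
    intro k' hk' hne
    refine subset_of_isPreconnected (E := E) hS.isClosed (hconv k').isPreconnected ?_ ?_ hne
    · intro a ha b hb
      simpa using sub_mem ha.2.1 hb.2.1
    · intro a ha haB
      have h0 := (hball a ha.1).1 haB
      have h1 := ha.2.2
      rcases hk' with rfl | rfl
      · rw [h0] at h1
        exact lt_irrefl _ h1
      · rw [inner_neg_left, h0, neg_zero] at h1
        exact lt_irrefl _ h1
  have hpush : ∀ k', (k' = k ∨ k' = -k) → ∀ y ∈ Metric.ball q η, y - q ∈ Eᗮ → 0 ≤ ⟪k', y - q⟫ →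
      ∀ᶠ a : ℝ in 𝓝[>] 0, y + a • k' ∈ H k' := by
    intro k' hk' y hy hyq hky
    have hk'E : k' ∈ Eᗮ := by rcases hk' with rfl | rfl <;> simp [hk]
    have hk'0 : k' ≠ 0 := by rcases hk' with rfl | rfl <;> simpa using hk0
    filter_upwards [(tendsto_add_smul_nhdsGT y k').eventually (Metric.isOpen_ball.mem_nhds hy),
      self_mem_nhdsWithin] with a ha ha0
    have ha0' : (0 : ℝ) < a := ha0
    refine ⟨ha, ?_, ?_⟩
    · rw [add_sub_right_comm]
      exact add_mem hyq (Eᗮ.smul_mem _ hk'E)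
    · rw [add_sub_right_comm, inner_add_right, inner_smul_right]
      have : 0 < ⟪k', k'⟫ := real_inner_self_pos.2 hk'0
      have := mul_pos ha0' this
      linarith
  have hclose : ∀ k', (k' = k ∨ k' = -k) → H k' ⊆ S → ∀ y ∈ Metric.ball q η, y - q ∈ Eᗮ →
      0 ≤ ⟪k', y - q⟫ → y ∈ S := fun k' hk' hH y hy hyq hky =>
    hS.isClosed.mem_of_tendsto (tendsto_add_smul_nhdsGT y k')
      ((hpush k' hk' y hy hyq hky).mono fun a ha => hH ha)
  have hface : ∀ k', (k' = k ∨ k' = -k) → ¬ H k' ⊆ S → H (-k') ⊆ S → IsFacePoint E S k' q := by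
    intro k' hk' h1 h2
    refine Metric.eventually_nhds_iff_ball.2 ⟨η, hη, fun y hy hyq => ⟨fun hyS => ?_, fun hky => ?_⟩⟩
    · by_contra hcon
      exact h1 (hsub k' hk' ⟨y, ⟨hy, hyq, not_le.1 hcon⟩, hyS⟩)
    · refine hclose (-k') ?_ h2 y hy hyq (by rw [inner_neg_left]; linarith)
      rcases hk' with rfl | rfl <;> simp
  -- Both halves in `S` would make `q` interior; neither in `S` would contradict purity. Exactly one
  -- half in `S` is a face point.
  by_cases h1 : H k ⊆ S <;> by_cases h2 : H (-k) ⊆ S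
  · refine absurd ⟨hq.1, ?_⟩ hq.2
    refine Metric.eventually_nhds_iff_ball.2 ⟨η, hη, fun y hy hyq => ?_⟩
    rcases le_total 0 ⟪k, y - q⟫ with h | h
    · exact hclose k (Or.inl rfl) h1 y hy hyq h
    · exact hclose (-k) (Or.inr rfl) h2 y hy hyq (by rw [inner_neg_left]; linarith)
  · exact Or.inr (hface (-k) (Or.inr rfl) h2 (by rwa [neg_neg]))
  · exact Or.inl (hface k (Or.inl rfl) h1 h2)
  · obtain ⟨a, hai, haq⟩ := Metric.mem_closure_iff.1 (hp hq.1) η hη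
    have haB : a ∈ Metric.ball q η := by rwa [Metric.mem_ball, dist_comm]
    have haE := ((hball a haB).2 hai.1).2
    have key : ∀ k', (k' = k ∨ k' = -k) → 0 ≤ ⟪k', a - q⟫ → H k' ⊆ S := by
      intro k' hk' h0
      have hk'E : k' ∈ Eᗮ := by rcases hk' with rfl | rfl <;> simp [hk]
      obtain ⟨c, hc, hc'⟩ := ((hpush k' hk' a haB haE h0).and
        ((tendsto_add_smul_nhdsGT a k').eventually hai.2)).exists
      exact hsub k' hk' ⟨_, hc, hc' (by simpa using Eᗮ.smul_mem c hk'E)⟩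
    rcases le_total 0 ⟪k, a - q⟫ with h | h
    · exact absurd (key k (Or.inl rfl) h) h1
    · exact absurd (key (-k) (Or.inr rfl) (by rw [inner_neg_left]; linarith)) h2

/-- Near each boundary point there is a boundary point where no two of the polytopes of the cover
meet transversally. -/
theorem IsBoundaryCover.exists_near_generic [FiniteDimensional ℝ V] {C : Set (Finset V)}
    (hC : IsBoundaryCover E S C) (hS : IsLocallyFlat E S) (hp : S ⊆ closure (perpInterior E S))
    {p : V} (hpB : p ∈ perpBoundary E S) {ε : ℝ} (hε : 0 < ε) :
    ∃ q ∈ perpBoundary E S, dist q p < ε ∧ ∀ s ∈ C, ∀ s' ∈ C, q ∈ convexHull ℝ (s : Set V) →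
      q ∈ convexHull ℝ (s' : Set V) → Module.finrank ℝ Eᗮ ≤
        Module.finrank ℝ (vectorSpan ℝ (s : Set V) ⊓ vectorSpan ℝ (s' : Set V) : Submodule ℝ V) + 1 := by
  obtain ⟨δ, hδ, hball⟩ := Metric.eventually_nhds_iff_ball.1 (hS p)
  let η := min ε δ
  have hη : 0 < η := lt_min hε hδ
  obtain ⟨a, hai, hap⟩ := Metric.mem_closure_iff.1 (hp hpB.1) η hη
  rw [dist_comm] at hap
  have haE : a - p ∈ Eᗮ := (hball a (hap.trans_le (min_le_right _ _)) hai.1).2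
  have hfreq : ∃ᶠ y in 𝓝 p, ¬ (y - p ∈ Eᗮ → y ∈ S) := by
    rw [← not_eventually]
    exact fun h => hpB.2 ⟨hpB.1, h⟩
  obtain ⟨b, hb, hbp⟩ := (hfreq.and_eventually (Metric.ball_mem_nhds p hη)).exists
  push Not at hb
  obtain ⟨hbE, hbS⟩ := hb
  obtain ⟨ε', hε', hbb⟩ := Metric.isOpen_iff.1
    (hS.isClosed.isOpen_compl.inter (Metric.isOpen_ball (x := p) (ε := η))) b ⟨hbS, hbp⟩
  let R := ‖p‖ + η
  let D : Finset V → Submodule ℝ V := fun s => vectorSpan ℝ (s : Set V)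
  let CR := {s ∈ C | (convexHull ℝ (s : Set V) ∩ Metric.closedBall 0 R).Nonempty}
  let I : Set (Finset V × Finset V) := {i | i ∈ CR ×ˢ CR ∧
    Module.finrank ℝ (D i.1 ⊓ D i.2 : Submodule ℝ V) + 1 < Module.finrank ℝ Eᗮ}
  have hI : I.Finite := ((hC.locallyFinite R).prod (hC.locallyFinite R)).subset fun i hi => hi.1
  -- A common point of each pair of polytopes; the default 0 serves pairs that do not meet and is
  -- never used for them.
  have hex : ∀ i : Finset V × Finset V, ∃ z : V,
      (convexHull ℝ (i.1 : Set V) ∩ convexHull ℝ (i.2 : Set V)).Nonempty →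
        z ∈ convexHull ℝ (i.1 : Set V) ∩ convexHull ℝ (i.2 : Set V) := by
    intro i
    by_cases h : (convexHull ℝ (i.1 : Set V) ∩ convexHull ℝ (i.2 : Set V)).Nonempty
    · exact ⟨h.choose, fun _ => h.choose_spec⟩
    · exact ⟨0, fun h' => absurd h' h⟩
  choose z hz using hex
  -- This contains the directions from the interior point `a` to the points common to the two
  -- polytopes. For a transversal pair it is too small to contain `Eᗮ`, so the segment from `a` to a
  -- point outside `S` can be tilted to miss all such intersections; it still crosses `∂S`.
  let M : Finset V × Finset V → Submodule ℝ V := fun i => (D i.1 ⊓ D i.2) ⊔ Submodule.span ℝ {z i - a}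
  have hM : ∀ i ∈ I, ¬ Eᗮ ≤ M i := by
    intro i hi hle
    have h1 := Submodule.finrank_mono hle
    have h2 : Module.finrank ℝ (M i) ≤ _ := Submodule.finrank_add_le_finrank_add_finrank _ _
    have h3 : Module.finrank ℝ (Submodule.span ℝ ({z i - a} : Set V)) ≤ 1 := by
      simpa using finrank_span_le_card (R := ℝ) ({z i - a} : Set V)
    have := hi.2
    omega
  have hbaE : b - a ∈ Eᗮ := by simpa using sub_mem hbE haE
  obtain ⟨w, hwE, hwn, hwM⟩ := exists_near_notMem hI M Eᗮ hM hbaE hε'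
  have hb' : a + w ∈ Metric.ball b ε' := by
    rw [Metric.mem_ball, dist_eq_norm]
    rwa [show a + w - b = w - (b - a) by abel]
  obtain ⟨hb'S, hb'p⟩ := hbb hb'
  have hseg : segment ℝ a (a + w) ⊆ Metric.ball p η :=
    (convex_ball p η).segment_subset hap hb'p
  have hmeet : ∃ q ∈ segment ℝ a (a + w), q ∈ perpBoundary E S := by
    by_contra! hcon
    refine hb'S (subset_of_isPreconnected (E := E) hS.isClosed
      (convex_segment a (a + w)).isPreconnected ?_ hcon ⟨a, left_mem_segment ℝ _ _, hai.1⟩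
      (right_mem_segment ℝ _ _))
    intro x hx y hy
    rw [segment_eq_image'] at hx hy
    obtain ⟨s, -, rfl⟩ := hx
    obtain ⟨t, -, rfl⟩ := hy
    simp only [add_sub_cancel_left, add_sub_add_left_eq_sub]
    exact sub_mem (Eᗮ.smul_mem _ hwE) (Eᗮ.smul_mem _ hwE)
  obtain ⟨q, hqs, hqB⟩ := hmeet
  have hqp := hseg hqs
  refine ⟨q, hqB, lt_of_lt_of_le hqp (min_le_left _ _), fun s hs s' hs' hqs1 hqs2 => ?_⟩
  by_contra! hlt
  have hqR : q ∈ Metric.closedBall (0 : V) R := by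
    rw [mem_closedBall_zero_iff]
    have := norm_add_le p (q - p)
    rw [add_sub_cancel] at this
    rw [Metric.mem_ball, dist_eq_norm] at hqp
    linarith
  have hi : (s, s') ∈ I := ⟨⟨⟨hs, q, hqs1, hqR⟩, hs', q, hqs2, hqR⟩, hlt⟩
  rw [segment_eq_image'] at hqs
  obtain ⟨τ, -, rfl⟩ := hqs
  simp only [add_sub_cancel_left] at *
  have hτ : τ ≠ 0 := by
    rintro rfl
    rw [zero_smul, add_zero] at hqB
    exact hqB.2 hai
  obtain ⟨hz1, hz2⟩ := hz (s, s') ⟨_, hqs1, hqs2⟩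
  refine hwM _ hi ?_
  have hsum : τ • w ∈ M (s, s') := by
    have : τ • w = (a + τ • w - z (s, s')) + (z (s, s') - a) := by abel
    rw [this]
    exact add_mem (Submodule.mem_sup_left ⟨sub_mem_vectorSpan_of_mem_convexHull hqs1 hz1,
      sub_mem_vectorSpan_of_mem_convexHull hqs2 hz2⟩)
      (Submodule.mem_sup_right (Submodule.mem_span_singleton_self _))
  have := (M (s, s')).smul_mem τ⁻¹ hsum
  rwa [smul_smul, inv_mul_cancel₀ hτ, one_smul] at this

/-- The boundary is the union of the closures of the relative interiors of the faces. -/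
theorem IsBoundaryCover.exists_mem_closure_faceInteriors [FiniteDimensional ℝ V]
    {C : Set (Finset V)} (hC : IsBoundaryCover E S C) (hS : IsLocallyFlat E S)
    (hp : S ⊆ closure (perpInterior E S)) {k : Finset V → V}
    (hk : ∀ s ∈ C, k s ∈ Eᗮ ∧ k s ≠ 0 ∧ ∀ v ∈ vectorSpan ℝ (s : Set V), ⟪k s, v⟫ = 0) {p : V}
    (hpB : p ∈ perpBoundary E S) :
    ∃ s ∈ C, p ∈ closure (faceInteriors E S (k s) ∩ convexHull ℝ (s : Set V)) := by
  let CR := {s ∈ C | (convexHull ℝ (s : Set V) ∩ Metric.closedBall 0 (‖p‖ + 1)).Nonempty}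
  have hfin : CR.Finite := hC.locallyFinite _
  have hmem : p ∈ closure (⋃ s ∈ CR, faceInteriors E S (k s) ∩ convexHull ℝ (s : Set V)) := by
    rw [Metric.mem_closure_iff]
    intro ε hε
    obtain ⟨q, hqB, hqp, hq⟩ := hC.exists_near_generic hS hp hpB (lt_min hε one_pos)
    obtain ⟨s, hs, hqs⟩ := hC.cover q hqB
    have hqR : q ∈ Metric.closedBall (0 : V) (‖p‖ + 1) := by
      rw [mem_closedBall_zero_iff]
      have := norm_add_le p (q - p)
      rw [add_sub_cancel] at this
      have h1 := hqp.trans_le (min_le_right _ _)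
      rw [dist_eq_norm] at h1
      linarith
    refine ⟨q, mem_iUnion₂.2 ⟨s, ⟨hs, q, hqs, hqR⟩, ?_, hqs⟩, ?_⟩
    · refine mem_faceInteriors_of_eventually hS hp (hk s hs).1 (hk s hs).2.1 hqB ?_
      filter_upwards [hC.locallyFinite.eventually_mem q] with y hy hyB
      obtain ⟨s', hs', hys'⟩ := hC.cover y hyB
      have hqs' := hy s' hs' hys'
      -- Both direction spaces are proper in `Eᗮ` and their intersection has codimension at most one
      -- there, so they coincide, and `k s` is normal to `s'` too.
      have hle := hq s hs s' hs' hqs hqs'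
      have h1 := Submodule.finrank_lt_finrank_of_lt (hC.lt s hs)
      have h2 := Submodule.finrank_lt_finrank_of_lt (hC.lt s' hs')
      have e1 := Submodule.eq_of_le_of_finrank_le
        (inf_le_left : vectorSpan ℝ (s : Set V) ⊓ vectorSpan ℝ (s' : Set V) ≤ _) (by omega)
      have e2 := Submodule.eq_of_le_of_finrank_le
        (inf_le_right : vectorSpan ℝ (s : Set V) ⊓ vectorSpan ℝ (s' : Set V) ≤ _) (by omega)
      refine (hk s hs).2.2 _ ?_
      rw [← e1, e2]
      exact sub_mem_vectorSpan_of_mem_convexHull hys' hqs'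
    · rw [dist_comm]
      exact hqp.trans_le (min_le_left _ _)
  rw [hfin.closure_biUnion] at hmem
  obtain ⟨s, hs, h⟩ := mem_iUnion₂.1 hmem
  exact ⟨s, hs.1, h⟩

end Faces

/-! ### Totally irrational subspaces have dense image in the torus -/

section Kronecker

variable {V : Type*} [NormedAddCommGroup V] [InnerProductSpace ℝ V]

/-- The union of the lines contained in an additive subgroup. -/
def linesIn (H : AddSubgroup V) : Submodule ℝ V where
  carrier := {v | ∀ t : ℝ, t • v ∈ H}
  add_mem' ha hb t := by
    rw [smul_add]
    exact add_mem (ha t) (hb t)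
  zero_mem' t := by simp
  smul_mem' c v hv t := by
    rw [smul_smul]
    exact hv _

theorem mem_of_mem_linesIn {H : AddSubgroup V} {v : V} (hv : v ∈ linesIn H) : v ∈ H := by
  simpa using hv 1

/-- Nonzero elements `h n` tending to 0 would have a limiting direction `u`. The multiples of `h n`
by `⌊t / ‖h n‖⌋` tend to `t • u`, so the closed group contains the line of `u`, although `u` is a
unit vector orthogonal to all such lines. -/
theorem exists_forall_eq_zero_of_mem_orthogonal_linesIn [FiniteDimensional ℝ V] {H : AddSubgroup V}
    (hH : IsClosed (H : Set V)) : ∃ ε > 0, ∀ h ∈ H, h ∈ (linesIn H)ᗮ → ‖h‖ < ε → h = 0 := by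
  by_contra! hcon
  have hpos : ∀ n : ℕ, (0 : ℝ) < 1 / ((n : ℝ) + 1) := fun n => by positivity
  choose h hH' hW hlt hne using fun n : ℕ => hcon _ (hpos n)
  have hn0 : ∀ n, 0 < ‖h n‖ := fun n => norm_pos_iff.2 (hne n)
  let 𝒰 := hyperfilter ℕ
  have hlim : Tendsto (fun n => ‖h n‖) 𝒰 (𝓝 0) :=
    (squeeze_zero (fun n => norm_nonneg _) (fun n => (hlt n).le)
      tendsto_one_div_add_atTop_nhds_zero_nat).mono_left Nat.hyperfilter_le_atTop
  obtain ⟨u, hu, hlimu⟩ := (isCompact_sphere (0 : V) 1).ultrafilter_le_nhds'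
    (𝒰.map fun n => ‖h n‖⁻¹ • h n) (by
      rw [Ultrafilter.mem_map]
      refine univ_mem' fun n => ?_
      simp [norm_smul, (hn0 n).ne'])
  have hlimu' : Tendsto (fun n => ‖h n‖⁻¹ • h n) 𝒰 (𝓝 u) := hlimu
  have huW : u ∈ (linesIn H)ᗮ :=
    ((linesIn H)ᗮ.closed_of_finiteDimensional).mem_of_tendsto hlimu'
      (Eventually.of_forall fun n => Submodule.smul_mem _ _ (hW n))
  have huH : u ∈ linesIn H := by
    intro t
    have h1 : Tendsto (fun n => (⌊t / ‖h n‖⌋ : ℝ) • h n) 𝒰 (𝓝 (t • u)) := by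
      have h2 : Tendsto (fun n => ((⌊t / ‖h n‖⌋ : ℝ) - t / ‖h n‖) • h n) 𝒰 (𝓝 0) := by
        rw [tendsto_zero_iff_norm_tendsto_zero]
        refine squeeze_zero (fun n => norm_nonneg _) (fun n => ?_) hlim
        rw [norm_smul, Real.norm_eq_abs, abs_sub_comm]
        refine mul_le_of_le_one_left (norm_nonneg _) (abs_le.2 ⟨?_, ?_⟩)
        · linarith [Int.floor_le (t / ‖h n‖)]
        · linarith [Int.lt_floor_add_one (t / ‖h n‖)]
      have h3 := h2.add (hlimu'.const_smul t)
      rw [zero_add] at h3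
      refine h3.congr fun n => ?_
      rw [smul_smul, sub_smul, div_eq_mul_inv, sub_add_cancel]
    refine hH.mem_of_tendsto h1 (Eventually.of_forall fun n => ?_)
    rw [Int.cast_smul_eq_zsmul]
    exact zsmul_mem (hH' n) _
  have hu0 : u = 0 := by
    have := (linesIn H).inf_orthogonal_eq_bot
    rw [Submodule.eq_bot_iff] at this
    exact this u ⟨huH, huW⟩
  rw [hu0] at hu
  simp at hu

/-- Let `W` be the space of lines. The projection of `L` to `Wᗮ` lies in `H`, so it is discrete, and
it spans `Wᗮ`; its rank is thus `dim Wᗮ`. By rank-nullity the kernel `W ∩ L` has rank `dim W`, and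
being discrete it spans `W`. -/
theorem isRational_linesIn [FiniteDimensional ℝ V] {L : Submodule ℤ V} [DiscreteTopology L]
    [IsZLattice ℝ L] {H : AddSubgroup V} (hH : IsClosed (H : Set V)) (hL : ∀ l ∈ L, l ∈ H) :
    IsRational L (linesIn H) := by
  let W := linesIn H
  change Submodule.span ℝ ((W : Set V) ∩ (L : Set V)) = W
  obtain ⟨ε, hε, hdisc⟩ := exists_forall_eq_zero_of_mem_orthogonal_linesIn hH
  let P : V →ₗ[ℝ] V := (Wᗮ.starProjection : V →L[ℝ] V)
  have hP : ∀ v, P v ∈ Wᗮ := fun v => Wᗮ.starProjection_apply_mem v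
  have hPW : ∀ v, v - P v ∈ W := fun v => by
    have h1 := Wᗮ.sub_starProjection_mem_orthogonal v
    rwa [Submodule.orthogonal_orthogonal] at h1
  have hP0 : ∀ v, P v = 0 ↔ v ∈ W := fun v => by
    refine ⟨fun h => by simpa [h] using hPW v, fun h => ?_⟩
    have h1 : P v ∈ W := by simpa using sub_mem h (hPW v)
    have := W.inf_orthogonal_eq_bot
    rw [Submodule.eq_bot_iff] at this
    exact this _ ⟨h1, hP v⟩
  let g : L →ₗ[ℤ] V := (P.restrictScalars ℤ) ∘ₗ L.subtype
  let D : Submodule ℤ V := LinearMap.range g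
  have hDH : ∀ d ∈ D, d ∈ H ∧ d ∈ Wᗮ := by
    rintro _ ⟨l, rfl⟩
    refine ⟨?_, hP _⟩
    have := sub_mem (hL l l.2) (mem_of_mem_linesIn (hPW l))
    rwa [sub_sub_cancel] at this
  have hDd : DiscreteTopology D := by
    rw [discreteTopology_iff_isOpen_singleton_zero, Metric.isOpen_singleton_iff]
    refine ⟨ε, hε, fun d hd => ?_⟩
    rw [dist_zero_right] at hd
    exact Subtype.ext (hdisc d (hDH d d.2).1 (hDH d d.2).2 hd)
  have hDspan : Submodule.span ℝ (D : Set V) = Wᗮ := by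
    refine le_antisymm (Submodule.span_le.2 fun d hd => (hDH d hd).2) fun v hv => ?_
    have hDP : (D : Set V) = P '' (L : Set V) := by
      ext d
      simp [D, g]
    rw [hDP, ← Submodule.map_span, IsZLattice.span_top]
    refine ⟨v, Submodule.mem_top, ?_⟩
    have h1 : v - P v ∈ Wᗮ := sub_mem hv (hP v)
    have := W.inf_orthogonal_eq_bot
    rw [Submodule.eq_bot_iff] at this
    exact (sub_eq_zero.1 (this _ ⟨hPW v, h1⟩)).symm
  let K : Submodule ℤ V := (LinearMap.ker g).map L.subtype
  have hK : (K : Set V) = (W : Set V) ∩ (L : Set V) := by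
    ext v
    simp only [K, Submodule.map_coe, mem_image, SetLike.mem_coe, LinearMap.mem_ker]
    constructor
    · rintro ⟨l, hl, rfl⟩
      exact ⟨(hP0 _).1 hl, l.2⟩
    · rintro ⟨hvW, hvL⟩
      exact ⟨⟨v, hvL⟩, (hP0 _).2 hvW, rfl⟩
  have hKd : DiscreteTopology K := by
    have : (K : Set V) ⊆ L := hK ▸ inter_subset_right
    exact DiscreteTopology.of_subset ‹DiscreteTopology L› this
  have rankD : Module.finrank ℝ Wᗮ = Module.finrank ℤ D := by
    have := Real.finrank_eq_int_finrank_of_discrete (s := (D : Set V)) (by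
      rw [Submodule.span_eq]; exact hDd)
    rw [Set.finrank, Set.finrank, Submodule.span_eq, hDspan] at this
    exact this
  have rankK : Module.finrank ℝ (Submodule.span ℝ (K : Set V)) = Module.finrank ℤ K := by
    have := Real.finrank_eq_int_finrank_of_discrete (s := (K : Set V)) (by
      rw [Submodule.span_eq]; exact hKd)
    rw [Set.finrank, Set.finrank, Submodule.span_eq] at this
    exact this
  have rankKer : Module.finrank ℤ K = Module.finrank ℤ (LinearMap.ker g) :=
    (Submodule.equivMapOfInjective L.subtype L.subtype_injective (LinearMap.ker g)).finrank_eq.symm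
  have : Module.Finite ℤ L := ZLattice.module_finite ℝ L
  have rankL : Module.finrank ℤ L = Module.finrank ℝ V := ZLattice.rank ℝ L
  have rankN := Submodule.finrank_quotient_add_finrank (LinearMap.ker g)
  rw [g.quotKerEquivRange.finrank_eq] at rankN
  have rankW := Submodule.finrank_add_finrank_orthogonal W
  rw [← hK]
  refine Submodule.eq_of_le_of_finrank_le ?_ ?_
  · rw [Submodule.span_le, hK]
    exact inter_subset_left
  · have : Module.finrank ℤ D = Module.finrank ℤ (LinearMap.range g) := rfl
    omega

/-- The translates of a totally irrational subspace by the lattice are dense. -/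
theorem IsTotallyIrrational.exists_near [FiniteDimensional ℝ V] {L : Submodule ℤ V}
    [DiscreteTopology L] [IsZLattice ℝ L] {E : Submodule ℝ V} (hE : IsTotallyIrrational L E)
    (z : V) {ε : ℝ} (hε : 0 < ε) : ∃ v ∈ E, ∃ l ∈ L, ‖z - (v + l)‖ < ε := by
  let G : AddSubgroup V := E.toAddSubgroup ⊔ L.toAddSubgroup
  let H := G.topologicalClosure
  have hGH : G ≤ H := G.le_topologicalClosure
  have hH : IsClosed (H : Set V) := G.isClosed_topologicalClosure
  have hLH : ∀ l ∈ L, l ∈ H := fun l hl =>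
    hGH ((le_sup_right : L.toAddSubgroup ≤ G) hl)
  have htop := hE _ (isRational_linesIn hH hLH) fun v hv t =>
    hGH ((le_sup_left : E.toAddSubgroup ≤ G) (E.smul_mem t hv))
  have hz : z ∈ H := mem_of_mem_linesIn (htop ▸ Submodule.mem_top)
  have hz' : z ∈ closure (G : Set V) := hz
  obtain ⟨y, hy, hzy⟩ := Metric.mem_closure_iff.1 hz' ε hε
  obtain ⟨v, hv, l, hl, rfl⟩ := AddSubgroup.mem_sup.1 hy
  exact ⟨v, hv, l, hl, by rwa [← dist_eq_norm]⟩

end Kronecker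

/-! ### Matching patterns -/

section Matching

variable {V : Type*} [NormedAddCommGroup V] [InnerProductSpace ℝ V] {E : Submodule ℝ V} {S : Set V}

/-- The bound on `‖g‖` keeps the matching point off the sphere that was added to the patch. -/
theorem exists_near_of_hausdorffEDist_patch_lt {X : Type*} [NormedAddCommGroup X] {A B : Set X} {ρ : ℝ}
    (hρ : 0 < ρ) (h : Metric.hausdorffEDist (patch A ρ) (patch B ρ) < ENNReal.ofReal (1 / ρ))
    {g : X} (hg : g ∈ A) (hgρ : ‖g‖ + 1 / ρ ≤ ρ) : ∃ g' ∈ B, ‖g' - g‖ < 1 / ρ := by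
  have h0 : 0 < 1 / ρ := by positivity
  have hgp : g ∈ patch A ρ := Or.inl ⟨hg, by simpa using by linarith⟩
  obtain ⟨g', hg', hlt⟩ := Metric.exists_edist_lt_of_hausdorffEDist_lt hgp h
  rw [edist_dist, ENNReal.ofReal_lt_ofReal_iff h0, dist_comm, dist_eq_norm] at hlt
  rcases hg' with hg' | hg'
  · exact ⟨g', hg'.1, hlt⟩
  · exfalso
    rw [mem_sphere_zero_iff_norm] at hg'
    have := norm_add_le g (g' - g)
    rw [add_sub_cancel] at this
    linarith

/-- The patterns of `x n` and `y n` match in larger and larger balls with smaller and smaller error. -/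
structure AsymptoticMatch (E : Submodule ℝ V) (S : Set V) (l : Filter ℕ) (x y : ℕ → V)
    (ρ : ℕ → ℝ) : Prop where
  radius : Tendsto ρ l atTop
  near : ∀ n, Metric.hausdorffEDist (patch (pattern E S (x n)) (ρ n)) (patch (pattern E S (y n)) (ρ n))
    < ENNReal.ofReal (1 / ρ n)

variable {l : Filter ℕ} {x y : ℕ → V} {ρ : ℕ → ℝ}

theorem AsymptoticMatch.symm (h : AsymptoticMatch E S l x y ρ) : AsymptoticMatch E S l y x ρ :=
  ⟨h.radius, fun n => by rw [Metric.hausdorffEDist_comm]; exact h.near n⟩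

theorem AsymptoticMatch.exists_tendsto (h : AsymptoticMatch E S l x y ρ) {g : ℕ → E} {g₀ : E}
    (hg : Tendsto g l (𝓝 g₀)) : ∃ g' : ℕ → E, Tendsto g' l (𝓝 g₀) ∧
      ∀ᶠ n in l, x n + (g n : V) ∈ S → y n + (g' n : V) ∈ S := by
  classical
  -- Where no match is guaranteed, `g n` itself is taken, so that convergence holds in all cases.
  have hex : ∀ n, ∃ g' : E, (0 < ρ n → ‖g' - g n‖ ≤ 1 / ρ n) ∧
      (0 < ρ n → ‖g n‖ + 1 / ρ n ≤ ρ n → x n + (g n : V) ∈ S → y n + (g' : V) ∈ S) := by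
    intro n
    by_cases hn : 0 < ρ n ∧ ‖g n‖ + 1 / ρ n ≤ ρ n ∧ x n + (g n : V) ∈ S
    · obtain ⟨g', hg', hlt⟩ := exists_near_of_hausdorffEDist_patch_lt hn.1 (h.near n)
        (g := g n) hn.2.2 hn.2.1
      exact ⟨g', fun _ => hlt.le, fun _ _ _ => hg'⟩
    · refine ⟨g n, fun h0 => ?_, fun h1 h2 h3 => absurd ⟨h1, h2, h3⟩ hn⟩
      rw [sub_self, norm_zero]
      positivity
  choose g' h1 h2 using hex
  have hpos := h.radius.eventually_gt_atTop 0
  have hinv : Tendsto (fun n => 1 / ρ n) l (𝓝 0) := by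
    simp only [one_div]
    exact h.radius.inv_tendsto_atTop
  have hsub : Tendsto (fun n => g' n - g n) l (𝓝 0) := by
    rw [tendsto_zero_iff_norm_tendsto_zero]
    exact squeeze_zero' (Eventually.of_forall fun n => norm_nonneg _)
      (hpos.mono fun n hn => h1 n hn) hinv
  refine ⟨g', by simpa using hsub.add hg, ?_⟩
  filter_upwards [hpos, (hg.norm.add hinv).eventually (gt_mem_nhds (lt_add_one _)),
    h.radius.eventually_ge_atTop (‖g₀‖ + 0 + 1)] with n hn hn1 hn2 hS
  exact h2 n hn (hn1.le.trans hn2) hS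

/-- Matching is exact at points that are in the same affine subspace parallel to `Eᗮ`. -/
theorem AsymptoticMatch.eventually_mem (h : AsymptoticMatch E S l x y ρ) (hS : IsLocallyFlat E S)
    {g g' : ℕ → E} {g₀ : E} (hg : Tendsto g l (𝓝 g₀)) (hg' : Tendsto g' l (𝓝 g₀)) {w : V}
    (hy : Tendsto (fun n => y n + (g' n : V)) l (𝓝 w))
    (hyw : ∀ᶠ n in l, y n + (g' n : V) - w ∈ Eᗮ) :
    ∀ᶠ n in l, x n + (g n : V) ∈ S → y n + (g' n : V) ∈ S := by
  obtain ⟨f, hf, hfS⟩ := h.exists_tendsto hg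
  have hlim : Tendsto (fun n => y n + (f n : V)) l (𝓝 w) := by
    have h1 : Tendsto (fun n => ((f n - g' n : E) : V)) l (𝓝 ((g₀ - g₀ : E) : V)) :=
      (continuous_subtype_val.tendsto _).comp (hf.sub hg')
    have h2 := hy.add h1
    simp only [sub_self, Submodule.coe_zero, add_zero] at h2
    refine h2.congr fun n => ?_
    simp
  -- By local flatness the approximate match is in the flat of `w`, like `y n + g' n`. Their
  -- difference is in `E` and in `Eᗮ`, hence zero.
  filter_upwards [hfS, hlim.eventually (hS w), hyw] with n h1 h2 h3 hx
  have hfy := h1 hx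
  have hperp : ((f n - g' n : E) : V) ∈ Eᗮ := by
    have := sub_mem (h2 hfy).2 h3
    rw [sub_sub_sub_cancel_right, add_sub_add_left_eq_sub] at this
    simpa using this
  have hz : ((f n - g' n : E) : V) = 0 := by
    have := E.inf_orthogonal_eq_bot
    rw [Submodule.eq_bot_iff] at this
    exact this _ ⟨(f n - g' n).2, hperp⟩
  have : f n = g' n := by
    rw [← sub_eq_zero]
    exact Subtype.ext hz
  rwa [this] at hfy

theorem perpInterior_add_mem {p : V} (hp : ∀ x, x + p ∈ S ↔ x ∈ S) {x : V}
    (hx : x ∈ perpInterior E S) : x + p ∈ perpInterior E S := by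
  refine ⟨(hp x).2 hx.1, ?_⟩
  have : Tendsto (fun y => y - p) (𝓝 (x + p)) (𝓝 x) := by
    have := (continuous_sub_right p).tendsto (x + p)
    rwa [add_sub_cancel_right] at this
  filter_upwards [this.eventually hx.2] with y hy hyx
  have := hy (by rwa [sub_sub, add_comm p])
  rw [← hp] at this
  simpa using this

variable {L : Submodule ℤ V}

theorem IsAtomicSurface.add_mem_iff (hS : IsAtomicSurface L E S) {p : V} (hp : p ∈ L) (x : V) :
    x + p ∈ S ↔ x ∈ S :=
  (hS.periods p).2 hp x

theorem IsAtomicSurface.add_mem_perpBoundary (hS : IsAtomicSurface L E S) {p : V} (hp : p ∈ L)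
    {x : V} (hx : x ∈ perpBoundary E S) : x + p ∈ perpBoundary E S := by
  refine ⟨(hS.add_mem_iff hp x).2 hx.1, fun hi => hx.2 ?_⟩
  simpa using perpInterior_add_mem (p := -p) (hS.add_mem_iff (neg_mem hp)) hi

variable [FiniteDimensional ℝ V]

/-- The component along `E`. -/
def along (E : Submodule ℝ V) (w : V) : E :=
  ⟨w - Eᗮ.starProjection w, by
    have := Eᗮ.sub_starProjection_mem_orthogonal w
    rwa [Submodule.orthogonal_orthogonal] at this⟩

theorem add_along (w : V) : Eᗮ.starProjection w + (along E w : V) = w := by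
  simp [along]

theorem continuous_along : Continuous (along E) :=
  Continuous.subtype_mk (continuous_id.sub (Eᗮ.starProjection).continuous) _

@[simp] theorem along_zero : along E (0 : V) = 0 := by
  simp [along]

/-- The cut of `x n` meets the flat of `x₀ + v` near that point, hence in `S`. Matching points in
the cuts of `y n` converge to `y₀ + v`, and `S` is closed. -/
theorem AsymptoticMatch.add_mem_of_mem_perpInterior [l.NeBot] (h : AsymptoticMatch E S l x y ρ)
    (hS : IsLocallyFlat E S) {x₀ y₀ : V} (hx : Tendsto x l (𝓝 x₀)) (hy : Tendsto y l (𝓝 y₀)) (v : E)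
    (hv : x₀ + (v : V) ∈ perpInterior E S) : y₀ + (v : V) ∈ S := by
  have hx0 : Tendsto (fun n => x n - x₀) l (𝓝 0) := by simpa using hx.sub_const x₀
  have hal : Tendsto (fun n => along E (x n - x₀)) l (𝓝 0) := by
    have := (continuous_along (E := E)).tendsto 0
    rw [along_zero] at this
    exact this.comp hx0
  have hg : Tendsto (fun n => v - along E (x n - x₀)) l (𝓝 v) := by
    simpa using hal.const_sub v
  obtain ⟨g', hg', hgS⟩ := h.exists_tendsto hg
  have hlim : Tendsto (fun n => x n + ((v - along E (x n - x₀) : E) : V)) l (𝓝 (x₀ + v)) :=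
    hx.add ((continuous_subtype_val.tendsto _).comp hg)
  have hlim' : Tendsto (fun n => y n + (g' n : V)) l (𝓝 (y₀ + v)) :=
    hy.add ((continuous_subtype_val.tendsto _).comp hg')
  refine hS.isClosed.mem_of_tendsto hlim' ?_
  filter_upwards [hgS, hlim.eventually hv.2] with n h1 h2
  refine h1 (h2 ?_)
  have : x n + ((v - along E (x n - x₀) : E) : V) - (x₀ + v) = Eᗮ.starProjection (x n - x₀) := by
    rw [eq_sub_of_add_eq (add_along (E := E) (x n - x₀)), Submodule.coe_sub]
    abel
  rw [this]
  exact Eᗮ.starProjection_apply_mem _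

variable [DiscreteTopology L]

/-- Points of the cut of `x₀` interior to `S` pass to the cut of `y₀`. Since `E + L` is dense,
translates of such points approximate all of `S`, so `y₀ - x₀` is a period. -/
theorem AsymptoticMatch.sub_mem_lattice [IsZLattice ℝ L] [l.NeBot] (h : AsymptoticMatch E S l x y ρ)
    (hE : IsTotallyIrrational L E) (hS : IsAtomicSurface L E S) {x₀ y₀ : V}
    (hx : Tendsto x l (𝓝 x₀)) (hy : Tendsto y l (𝓝 y₀)) : y₀ - x₀ ∈ L := by
  have key : ∀ {x y : ℕ → V} {x₀ y₀ : V}, AsymptoticMatch E S l x y ρ → Tendsto x l (𝓝 x₀) →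
      Tendsto y l (𝓝 y₀) → ∀ z ∈ S, z + (y₀ - x₀) ∈ S := by
    intro x y x₀ y₀ h hx hy
    have hcl := hS.isLocallyFlat.isClosed
    have hint : ∀ z ∈ perpInterior E S, z + (y₀ - x₀) ∈ S := by
      intro z hz
      obtain ⟨δ, hδ, hball⟩ := Metric.eventually_nhds_iff_ball.1 (eventually_mem_perpInterior hz)
      rw [← hcl.closure_eq, Metric.mem_closure_iff]
      intro ε hε
      obtain ⟨v, hv, p, hp, hlt⟩ := hE.exists_near (z - x₀) (lt_min hε hδ)
      set e := z - x₀ - (v + p) with he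
      set b := Eᗮ.starProjection e with hb
      have hbE : b ∈ Eᗮ := Eᗮ.starProjection_apply_mem _
      have hbn : ‖b‖ < min ε δ := (Eᗮ.norm_starProjection_apply_le e).trans_lt hlt
      have hab : b + (along E e : V) = e := add_along e
      -- Absorbing the part of the error along `E` leaves the error `b` in the flat of `z`, where
      -- interior points have interior neighbours.
      let v' : E := ⟨v, hv⟩ + along E e
      have hz' : x₀ + (v' : V) + p = z - b := by
        have : (v' : V) = v + (e - b) := by rw [← hab]; simp [v']
        rw [this, he]
        abel
      have hmem : z - b ∈ perpInterior E S := by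
        refine hball _ ?_ (by simpa using hbE)
        rw [Metric.mem_ball, dist_eq_norm, sub_sub_cancel_left, norm_neg]
        exact hbn.trans_le (min_le_right _ _)
      have hmem' : x₀ + (v' : V) ∈ perpInterior E S := by
        have := perpInterior_add_mem (p := -p) (hS.add_mem_iff (neg_mem hp)) hmem
        rwa [← hz', add_neg_cancel_right] at this
      have hyS := (hS.add_mem_iff hp _).2
        (h.add_mem_of_mem_perpInterior hS.isLocallyFlat hx hy v' hmem')
      refine ⟨_, hyS, ?_⟩
      have : z + (y₀ - x₀) - (y₀ + (v' : V) + p) = b := by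
        have : z + (y₀ - x₀) - (y₀ + (v' : V) + p) = z - (x₀ + (v' : V) + p) := by abel
        rw [this, hz', sub_sub_cancel]
      rw [dist_eq_norm, this]
      exact hbn.trans_le (min_le_left _ _)
    intro z hz
    have hc : Continuous fun z => z + (y₀ - x₀) := by fun_prop
    have := map_mem_closure hc (hS.pure hz) hint
    rwa [hcl.closure_eq] at this
  refine (hS.periods _).1 fun z => ⟨fun hz => ?_, key h hx hy z⟩
  have := key h.symm hy hx _ hz
  rwa [add_assoc, ← neg_sub x₀ y₀, neg_add_cancel, add_zero] at this

/-- If `x n` and `y n` have the same limit and their patterns match better and better, then, in the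
direction orthogonal to `E`, the segment from `x n` to `y n` is not near an obstacle. -/
theorem AsymptoticMatch.eventually_notMem_perpBoundary {l : Ultrafilter ℕ}
    (h : AsymptoticMatch E S l x y ρ) (hS : IsAtomicSurface L E S) (hF : FacesAreCrossed E S)
    (hxn : ∀ n, IsNonsingular E S (x n)) (hyn : ∀ n, IsNonsingular E S (y n)) {x₀ : V}
    (hx : Tendsto x l (𝓝 x₀)) (hy : Tendsto y l (𝓝 x₀)) (R : ℝ) :
    ∀ᶠ n in l, ∀ t ∈ Icc (0 : ℝ) 1, ∀ v : E, ‖v‖ ≤ R →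
      x n + t • Eᗮ.starProjection (y n - x n) + (v : V) ∉ perpBoundary E S := by
  have hflat := hS.isLocallyFlat
  obtain ⟨C, hC⟩ := hS.exists_isBoundaryCover
  have hk : ∀ s : Finset V, ∃ k : V, s ∈ C → k ∈ Eᗮ ∧ k ≠ 0 ∧
      ∀ v ∈ vectorSpan ℝ (s : Set V), ⟪k, v⟫ = 0 := by
    intro s
    by_cases hs : s ∈ C
    · obtain ⟨k, h1, h2, h3⟩ := exists_normal (hC.lt s hs)
      exact ⟨k, fun _ => ⟨h1, h2, h3⟩⟩
    · exact ⟨0, fun h => absurd h hs⟩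
  choose k hk using hk
  set b : ℕ → V := fun n => Eᗮ.starProjection (y n - x n) with hb
  let a : ℕ → E := fun n => along E (y n - x n)
  have hab : ∀ n, y n = x n + b n + (a n : V) := fun n => by
    rw [add_assoc, add_along, add_sub_cancel]
  have hbE : ∀ n, b n ∈ Eᗮ := fun n => Eᗮ.starProjection_apply_mem _
  have hyx : Tendsto (fun n => y n - x n) l (𝓝 0) := by simpa using hy.sub hx
  have ha0 : Tendsto a l (𝓝 0) := by
    have := (continuous_along (E := E)).tendsto 0
    rw [along_zero] at this
    exact this.comp hyx
  have hb0 : Tendsto b l (𝓝 0) := by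
    have := (Eᗮ.starProjection : V →L[ℝ] V).continuous.tendsto 0
    rw [map_zero] at this
    exact this.comp hyx
  by_contra hcon
  rw [← Ultrafilter.eventually_not] at hcon
  have hex : ∀ n, ∃ f : ℝ × E, f.1 ∈ Icc (0 : ℝ) 1 ∧ ‖f.2‖ ≤ max R 0 ∧
      ((¬ ∀ t ∈ Icc (0 : ℝ) 1, ∀ v : E, ‖v‖ ≤ R → x n + t • b n + (v : V) ∉ perpBoundary E S) →
        x n + f.1 • b n + (f.2 : V) ∈ perpBoundary E S) := by
    intro n
    by_cases hn : ∀ t ∈ Icc (0 : ℝ) 1, ∀ v : E, ‖v‖ ≤ R → x n + t • b n + (v : V) ∉ perpBoundary E S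
    · exact ⟨0, by simp, by simp, fun h => absurd hn h⟩
    · have hn' := hn
      push Not at hn'
      obtain ⟨t, ht, v, hv, hmem⟩ := hn'
      exact ⟨(t, v), ht, hv.trans (le_max_left _ _), fun _ => hmem⟩
  choose f hft hfv hfB using hex
  let t : ℕ → ℝ := fun n => (f n).1
  let v : ℕ → E := fun n => (f n).2
  let z : ℕ → V := fun n => x n + t n • b n + (v n : V)
  have hzB : ∀ᶠ n in (l : Filter ℕ), z n ∈ perpBoundary E S := hcon.mono fun n hn => hfB n hn
  obtain ⟨v₀, -, hv₀⟩ := (isCompact_closedBall (0 : E) (max R 0)).ultrafilter_le_nhds'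
    (l.map v) (by
      rw [Ultrafilter.mem_map]
      exact univ_mem' fun n => by simpa using hfv n)
  have hvlim : Tendsto v l (𝓝 v₀) := hv₀
  have hvlim' : Tendsto (fun n => (v n : V)) l (𝓝 v₀) := (continuous_subtype_val.tendsto _).comp hvlim
  have htb : Tendsto (fun n => t n • b n) l (𝓝 0) := by
    rw [tendsto_zero_iff_norm_tendsto_zero] at hb0 ⊢
    refine squeeze_zero (fun n => norm_nonneg _) (fun n => ?_) hb0
    rw [norm_smul, Real.norm_of_nonneg (hft n).1]
    exact mul_le_of_le_one_left (norm_nonneg _) (hft n).2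
  let z₀ : V := x₀ + v₀
  have hzlim : Tendsto z l (𝓝 z₀) := by
    have := (hx.add htb).add hvlim'
    simpa using this
  let CR := {s ∈ C | (convexHull ℝ (s : Set V) ∩ Metric.closedBall 0 (‖z₀‖ + 1)).Nonempty}
  have hfin : CR.Finite := hC.locallyFinite _
  have hclconv : ∀ s : Finset V, closure (faceInteriors E S (k s) ∩ convexHull ℝ (s : Set V)) ⊆
      convexHull ℝ (s : Set V) := fun s =>
    closure_minimal inter_subset_right (isClosed_convexHull_finset s)
  have hzs : ∀ᶠ n in (l : Filter ℕ), ∃ s ∈ CR,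
      z n ∈ closure (faceInteriors E S (k s) ∩ convexHull ℝ (s : Set V)) := by
    filter_upwards [hzB, hzlim.norm.eventually (gt_mem_nhds (lt_add_one _))] with n hn hnn
    obtain ⟨s, hs, hmem⟩ := hC.exists_mem_closure_faceInteriors hflat hS.pure (fun s hs => hk s hs) hn
    exact ⟨s, ⟨hs, z n, hclconv s hmem, by simpa using hnn.le⟩, hmem⟩
  -- Pigeonhole: the ultrafilter selects one of the finitely many nearby polytopes.
  have hzs' : ∃ s ∈ CR, ∀ᶠ n in (l : Filter ℕ),
      z n ∈ closure (faceInteriors E S (k s) ∩ convexHull ℝ (s : Set V)) := by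
    have : (⋃ s ∈ CR, {n | z n ∈ closure (faceInteriors E S (k s) ∩ convexHull ℝ (s : Set V))}) ∈ l := by
      refine mem_of_superset hzs fun n hn => ?_
      obtain ⟨s, hs, hmem⟩ := hn
      exact mem_iUnion₂.2 ⟨s, hs, hmem⟩
    exact (Ultrafilter.finite_biUnion_mem_iff hfin).1 this
  obtain ⟨s, hsR, hs⟩ := hzs'
  have hsC := hsR.1
  obtain ⟨hkE, hk0, hkW⟩ := hk s hsC
  have hz₀ : z₀ ∈ closure (faceInteriors E S (k s) ∩ convexHull ℝ (s : Set V)) :=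
    isClosed_closure.mem_of_tendsto hzlim hs
  obtain ⟨u, hu, huF⟩ := hF (k s) hkE hk0 z₀ (closure_mono inter_subset_left hz₀)
  let u' : E := ⟨u, hu⟩
  obtain ⟨k', hk'E, hk'0, hk'W, hface⟩ : ∃ k' ∈ Eᗮ, k' ≠ 0 ∧
      (∀ v ∈ vectorSpan ℝ (s : Set V), ⟪k', v⟫ = 0) ∧ IsFacePoint E S k' (z₀ + u) := by
    rcases huF with huF | huF
    · exact ⟨k s, hkE, hk0, hkW, huF⟩
    · exact ⟨-k s, neg_mem hkE, neg_ne_zero.2 hk0,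
        fun v hv => by rw [inner_neg_left, hkW v hv, neg_zero], huF⟩
  -- The test points `x n + g n` and `y n + g' n` differ by `b n`. Both lie in the flat of `z₀ + u`,
  -- displaced from the hyperplane of the face by `-t n • b n` and `(1 - t n) • b n`, so on weakly
  -- opposite sides.
  let g : ℕ → E := fun n => v n + u'
  let g' : ℕ → E := fun n => v n + u' - a n
  have hg : Tendsto g l (𝓝 (v₀ + u')) := hvlim.add_const u'
  have hg' : Tendsto g' l (𝓝 (v₀ + u')) := by simpa using hg.sub ha0
  have hα : ∀ n, x n + (g n : V) - (z₀ + u) = (z n - z₀) - t n • b n := fun n => by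
    simp only [g, u', z, Submodule.coe_add]
    abel
  have hβ : ∀ n, y n + (g' n : V) - (z₀ + u) = (z n - z₀) + (1 - t n) • b n := fun n => by
    rw [hab n]
    simp only [g', u', z, Submodule.coe_add, Submodule.coe_sub, sub_smul, one_smul]
    abel
  have hαlim : Tendsto (fun n => x n + (g n : V)) l (𝓝 (z₀ + u)) := by
    have := hx.add ((continuous_subtype_val.tendsto _).comp hg)
    rw [Submodule.coe_add, ← add_assoc] at this
    exact this
  have hβlim : Tendsto (fun n => y n + (g' n : V)) l (𝓝 (z₀ + u)) := by
    have := hy.add ((continuous_subtype_val.tendsto _).comp hg')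
    rw [Submodule.coe_add, ← add_assoc] at this
    exact this
  have hzW : ∀ᶠ n in (l : Filter ℕ), z n - z₀ ∈ vectorSpan ℝ (s : Set V) := by
    filter_upwards [hs] with n hn
    exact sub_mem_vectorSpan_of_mem_convexHull (hclconv s hn) (hclconv s hz₀)
  have hαE : ∀ᶠ n in (l : Filter ℕ), x n + (g n : V) - (z₀ + u) ∈ Eᗮ := by
    filter_upwards [hzW] with n hn
    rw [hα]
    exact sub_mem ((hC.lt s hsC).le hn) (Eᗮ.smul_mem _ (hbE n))
  have hβE : ∀ᶠ n in (l : Filter ℕ), y n + (g' n : V) - (z₀ + u) ∈ Eᗮ := by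
    filter_upwards [hzW] with n hn
    rw [hβ]
    exact add_mem ((hC.lt s hsC).le hn) (Eᗮ.smul_mem _ (hbE n))
  have hbd := hface.eventually_mem_perpBoundary hk'E hk'0
  obtain ⟨n, hnW, hnα, hnβ, fα, fβ, bα, bβ, mαβ, mβα⟩ := (hzW.and (hαE.and (hβE.and
    ((hαlim.eventually hface).and ((hβlim.eventually hface).and ((hαlim.eventually hbd).and
    ((hβlim.eventually hbd).and ((h.eventually_mem hflat hg hg' hβlim hβE).and
    (h.symm.eventually_mem hflat hg' hg hαlim hαE))))))))).exists
  have iα : ⟪k', x n + (g n : V) - (z₀ + u)⟫ = -(t n * ⟪k', b n⟫) := by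
    rw [hα, inner_sub_right, hk'W _ hnW, inner_smul_right, zero_sub]
  have iβ : ⟪k', y n + (g' n : V) - (z₀ + u)⟫ = (1 - t n) * ⟪k', b n⟫ := by
    rw [hβ, inner_add_right, hk'W _ hnW, inner_smul_right, zero_add]
  have nα := fun h0 => hxn n (g n) (bα hnα h0)
  have nβ := fun h0 => hyn n (g' n) (bβ hnβ h0)
  have eα := fα hnα
  have eβ := fβ hnβ
  rw [iα] at eα nα
  rw [iβ] at eβ nβ
  have ht := hft n
  change t n ∈ Icc (0 : ℝ) 1 at ht
  -- The test point on the inner side is in `S`, so by exact matching the other one is too. This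
  -- forces it onto the hyperplane, hence into `∂S`.
  rcases le_total 0 ⟪k', b n⟫ with hc | hc
  · have h1 := eβ.1 (mαβ (eα.2 (by have := mul_nonneg ht.1 hc; linarith)))
    exact nβ (le_antisymm h1 (mul_nonneg (by linarith [ht.2]) hc))
  · have h1 := eα.1 (mβα (eβ.2 (mul_nonpos_of_nonneg_of_nonpos (by linarith [ht.2]) hc)))
    have h2 := mul_nonpos_of_nonneg_of_nonpos ht.1 hc
    exact nα (by linarith)

end Matching

/-! ### Norms on a finite-dimensional space -/

section Norms

variable {X : Type*} [NormedAddCommGroup X] [NormedSpace ℝ X] [FiniteDimensional ℝ X]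

theorem exists_seminorm_le (ν : Seminorm ℝ X) : ∃ C, 0 ≤ C ∧ ∀ v, ν v ≤ C * ‖v‖ := by
  let b := Module.finBasis ℝ X
  let f : X →L[ℝ] (Fin (Module.finrank ℝ X) → ℝ) := LinearMap.toContinuousLinearMap b.equivFun.toLinearMap
  refine ⟨‖f‖ * ∑ i, ν (b i), mul_nonneg (norm_nonneg _) (Finset.sum_nonneg fun i _ => apply_nonneg ν _),
    fun v => ?_⟩
  have hs : ∀ (s : Finset (Fin (Module.finrank ℝ X))), ν (∑ i ∈ s, f v i • b i) ≤
      ∑ i ∈ s, ‖f v i‖ * ν (b i) := by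
    classical
    intro s
    induction s using Finset.induction_on with
    | empty => simp
    | insert i s hi ih =>
      rw [Finset.sum_insert hi, Finset.sum_insert hi]
      refine (map_add_le_add ν _ _).trans (add_le_add ?_ ih)
      rw [map_smul_eq_mul]
  have hv : ∑ i, f v i • b i = v := b.sum_equivFun v
  calc ν v = ν (∑ i, f v i • b i) := by rw [hv]
    _ ≤ ∑ i, ‖f v i‖ * ν (b i) := hs _
    _ ≤ ∑ i, (‖f‖ * ‖v‖) * ν (b i) := by
      refine Finset.sum_le_sum fun i _ => mul_le_mul_of_nonneg_right ?_ (apply_nonneg ν _)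
      exact (norm_le_pi_norm (f v) i).trans (f.le_opNorm v)
    _ = _ := by rw [← Finset.mul_sum]; ring

theorem continuous_seminorm (ν : Seminorm ℝ X) : Continuous ν := by
  obtain ⟨C, hC, h⟩ := exists_seminorm_le ν
  refine (LipschitzWith.of_dist_le_mul (K := ⟨C, hC⟩) fun x y => ?_).continuous
  rw [Real.dist_eq, dist_eq_norm]
  exact (abs_sub_map_le_sub ν x y).trans (h _)

theorem exists_norm_le_seminorm (ν : Seminorm ℝ X) (hν : ∀ v, ν v = 0 → v = 0) :
    ∃ C, 0 ≤ C ∧ ∀ v, ‖v‖ ≤ C * ν v := by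
  rcases (Metric.sphere (0 : X) 1).eq_empty_or_nonempty with he | hne
  · refine ⟨0, le_rfl, fun v => ?_⟩
    by_contra hv
    have hv0 : ‖v‖ ≠ 0 := fun h => hv (by simp [h])
    have : ‖v‖⁻¹ • v ∈ Metric.sphere (0 : X) 1 := by simp [norm_smul, hv0]
    rw [he] at this
    exact this
  · obtain ⟨u, hu, hmin⟩ := (isCompact_sphere (0 : X) 1).exists_isMinOn hne
      (continuous_seminorm ν).continuousOn
    have hu0 : 0 < ν u := by
      refine lt_of_le_of_ne (apply_nonneg ν u) fun h => ?_
      rw [hν u h.symm] at hu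
      simp at hu
    refine ⟨(ν u)⁻¹, by positivity, fun v => ?_⟩
    rcases eq_or_ne v 0 with rfl | hv
    · simp
    have hv0 : 0 < ‖v‖ := norm_pos_iff.2 hv
    have h1 : ν u ≤ ν (‖v‖⁻¹ • v) := hmin (by simp [norm_smul, hv0.ne'])
    rw [map_smul_eq_mul, Real.norm_of_nonneg (by positivity), inv_mul_eq_div, le_div_iff₀ hv0] at h1
    rw [inv_mul_eq_div, le_div_iff₀ hu0]
    linarith

theorem isCompact_seminorm_le (ν : Seminorm ℝ X) (hν : ∀ v, ν v = 0 → v = 0) (r : ℝ) :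
    IsCompact {v | ν v ≤ r} := by
  obtain ⟨C, hC, h⟩ := exists_norm_le_seminorm ν hν
  refine Metric.isCompact_of_isClosed_isBounded
    (isClosed_le (continuous_seminorm ν) continuous_const) ?_
  refine (Metric.isBounded_closedBall (x := (0 : X)) (r := C * r)).subset fun v hv => ?_
  rw [mem_closedBall_zero_iff]
  exact (h v).trans (mul_le_mul_of_nonneg_left hv hC)

end Norms

/-! ### Patches with matching points -/

section Patches

variable {X : Type*} [NormedAddCommGroup X] [NormedSpace ℝ X]

/-- A matching point outside the ball is replaced by the point where the segment to it crosses the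
sphere, which belongs to both patches. -/
theorem hausdorffEDist_patch_le {A B : Set X} {ρ ε : ℝ}
    (hAB : ∀ v ∈ A, ‖v‖ ≤ ρ → ∃ v' ∈ B, ‖v' - v‖ ≤ ε)
    (hBA : ∀ v ∈ B, ‖v‖ ≤ ρ → ∃ v' ∈ A, ‖v' - v‖ ≤ ε) :
    Metric.hausdorffEDist (patch A ρ) (patch B ρ) ≤ ENNReal.ofReal ε := by
  have key : ∀ {A B : Set X}, (∀ v ∈ A, ‖v‖ ≤ ρ → ∃ v' ∈ B, ‖v' - v‖ ≤ ε) →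
      ∀ x ∈ patch A ρ, ∃ y ∈ patch B ρ, edist x y ≤ ENNReal.ofReal ε := by
    intro A B h x hx
    rcases hx with ⟨hxA, hxρ⟩ | hx
    · rw [mem_closedBall_zero_iff] at hxρ
      obtain ⟨y, hyB, hy⟩ := h x hxA hxρ
      by_cases hyρ : ‖y‖ ≤ ρ
      · refine ⟨y, Or.inl ⟨hyB, by simpa using hyρ⟩, ?_⟩
        rw [edist_comm, edist_dist, dist_eq_norm]
        exact ENNReal.ofReal_le_ofReal hy
      · have hcont : ContinuousOn (fun s : ℝ => ‖x + s • (y - x)‖) (Icc 0 1) := by fun_prop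
        obtain ⟨s, hs, hst⟩ := intermediate_value_Icc zero_le_one hcont
          (show ρ ∈ Icc _ _ by simpa using ⟨hxρ, (not_le.1 hyρ).le⟩)
        refine ⟨x + s • (y - x), Or.inr (by simpa using hst), ?_⟩
        rw [edist_comm, edist_dist, dist_eq_norm]
        refine ENNReal.ofReal_le_ofReal (le_trans ?_ hy)
        rw [add_sub_cancel_left, norm_smul, Real.norm_of_nonneg hs.1]
        exact mul_le_of_le_one_left (norm_nonneg _) hs.2
    · exact ⟨x, Or.inr hx, by simp⟩
  refine Metric.hausdorffEDist_le_of_mem_edist (key hAB) (key hBA)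

end Patches

/-! ### Paths in the torus -/

section Lifting

variable {V : Type*} [NormedAddCommGroup V] {L : Submodule ℤ V}

theorem exists_forall_lattice_eq_zero (L : Submodule ℤ V) [DiscreteTopology L] :
    ∃ δ > 0, ∀ l ∈ L, ‖l‖ < δ → l = 0 := by
  have h := discreteTopology_iff_isOpen_singleton_zero.1 ‹DiscreteTopology L›
  rw [Metric.isOpen_singleton_iff] at h
  obtain ⟨δ, hδ, h⟩ := h
  refine ⟨δ, hδ, fun l hl hn => ?_⟩
  have := h ⟨l, hl⟩ (by rw [dist_zero_right]; exact hn)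
  exact congrArg Subtype.val this

/-- A short path in the torus lifts to the ambient space. -/
theorem exists_lift {δ η : ℝ} (hδ : ∀ l ∈ L, ‖l‖ < δ → l = 0) (hη : 0 < η) (hηδ : 4 * η ≤ δ)
    {γ : ℝ → V ⧸ L} {a b : ℝ} (hab : a ≤ b) (hγ : ContinuousOn γ (Icc a b)) {x : V}
    (ha : γ a = Submodule.Quotient.mk x)
    (hlt : ∀ t ∈ Icc a b, ‖γ t - Submodule.Quotient.mk x‖ < η) :
    ∃ c : ℝ → V, ContinuousOn c (Icc a b) ∧ c a = x ∧
      ∀ t ∈ Icc a b, Submodule.Quotient.mk (c t) = γ t ∧ ‖c t - x‖ < η := by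
  have hex : ∀ t, ∃ m : V, t ∈ Icc a b → Submodule.Quotient.mk m = γ t ∧ ‖m - x‖ < η := by
    intro t
    by_cases ht : t ∈ Icc a b
    · obtain ⟨m, hm, hmn⟩ := Submodule.Quotient.norm_mk_lt (S := L)
        (γ t - Submodule.Quotient.mk x) (sub_pos.2 (hlt t ht))
      refine ⟨m + x, fun _ => ⟨?_, ?_⟩⟩
      · rw [Submodule.Quotient.mk_add, hm, sub_add_cancel]
      · rw [add_sub_cancel_right]
        linarith
    · exact ⟨0, fun h => absurd h ht⟩
  choose c hc using hex
  refine ⟨c, ?_, ?_, hc⟩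
  · intro t ht
    rw [Metric.continuousWithinAt_iff']
    intro ε hε
    -- Two values of `c` differ by less than `2 * η`, and so does the short representative of their
    -- difference in the quotient. The lattice vector separating these is shorter than `4 * η ≤ δ`,
    -- hence zero.
    have hε' : 0 < min ε (2 * η) := lt_min hε (by linarith)
    filter_upwards [Metric.continuousWithinAt_iff'.1 (hγ t ht) _ hε', self_mem_nhdsWithin] with s hs hsI
    obtain ⟨h1, h2⟩ := hc s hsI
    obtain ⟨h3, h4⟩ := hc t ht
    rw [dist_eq_norm, ← h1, ← h3, ← Submodule.Quotient.mk_sub] at hs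
    obtain ⟨m, hm, hmn⟩ := Submodule.Quotient.norm_mk_lt (S := L)
      (Submodule.Quotient.mk (c s - c t)) (sub_pos.2 hs)
    rw [add_sub_cancel] at hmn
    have hl : m - (c s - c t) ∈ L := (Submodule.Quotient.eq L).1 hm
    have h5 : ‖c s - c t‖ < 2 * η := by
      have : c s - c t = (c s - x) - (c t - x) := by abel
      rw [this]
      exact (norm_sub_le _ _).trans_lt (by linarith)
    have h0 := hδ _ hl (by
      have := norm_sub_le m (c s - c t)
      have := hmn.trans_le (min_le_right _ _)
      linarith)
    rw [dist_eq_norm, ← sub_eq_zero.1 h0]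
    exact hmn.trans_le (min_le_left _ _)
  · obtain ⟨h1, h2⟩ := hc a ⟨le_rfl, hab⟩
    rw [ha] at h1
    exact sub_eq_zero.1 (hδ _ ((Submodule.Quotient.eq L).1 h1) (by linarith))

theorem innerEDist_segment_le [NormedSpace ℝ V] {Y : Set (V ⧸ L)} (x w : V)
    (h : ∀ t ∈ Icc (0 : ℝ) 1, Submodule.Quotient.mk (x + t • w) ∉ Y) :
    innerEDist Y (Submodule.Quotient.mk x) (Submodule.Quotient.mk (x + w)) ≤ ENNReal.ofReal ‖w‖ := by
  let γ : ℝ → V ⧸ L := fun t => Submodule.Quotient.mk (x + t • w)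
  have hL : LipschitzWith ‖w‖₊ γ := by
    refine LipschitzWith.of_dist_le_mul fun s t => ?_
    rw [dist_eq_norm, ← Submodule.Quotient.mk_sub]
    refine (Submodule.Quotient.norm_mk_le L _).trans ?_
    rw [add_sub_add_left_eq_sub, ← sub_smul, norm_smul, mul_comm, Real.dist_eq, coe_nnnorm,
      Real.norm_eq_abs]
  refine (innerEDist_le (γ := γ) zero_le_one hL.continuous.continuousOn (by simp [γ]) (by simp [γ])
    h).trans ?_
  have h1 := (hL.lipschitzOnWith (s := univ)).comp_eVariationOn_le (g := id) (s := Icc (0 : ℝ) 1)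
    (mapsTo_univ _ _)
  have h2 := (monotone_id.monotoneOn (Icc (0 : ℝ) 1)).eVariationOn_eq
    (left_mem_Icc.2 zero_le_one) (right_mem_Icc.2 zero_le_one)
  rw [inter_self, id, id, sub_zero, ENNReal.ofReal_one] at h2
  rw [h2, mul_one] at h1
  rw [ofReal_norm]
  exact h1

end Lifting

/-! ### Obstacles lifted to the ambient space, and transport of patterns along paths -/

section Obstacles

variable {V : Type*} [NormedAddCommGroup V] [InnerProductSpace ℝ V] {L : Submodule ℤ V}
  {E : Submodule ℝ V} {S : Set V} {ν : Seminorm ℝ E} {r : ℝ}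

theorem IsAtomicSurface.mk_mem_obstacle (hS : IsAtomicSurface L E S) {p : V} :
    (Submodule.Quotient.mk p : V ⧸ L) ∈ obstacle L E S ν r ↔
      ∃ v : E, ν v ≤ r ∧ p + (v : V) ∈ perpBoundary E S := by
  constructor
  · rintro ⟨x, hx, v, hv, hz⟩
    have hl := (Submodule.Quotient.eq L).1 hz
    refine ⟨-v, by rwa [map_neg_eq_map], ?_⟩
    have := hS.add_mem_perpBoundary hl hx
    convert this using 1
    simp only [Submodule.coe_neg]
    abel
  · rintro ⟨v, hv, hp⟩
    exact ⟨_, hp, -v, by rwa [map_neg_eq_map], by simp⟩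

theorem IsAtomicSurface.mk_notMem_obstacle (hS : IsAtomicSurface L E S) {p : V}
    (hp : IsNonsingular E S p) : (Submodule.Quotient.mk p : V ⧸ L) ∉ obstacle L E S ν r := by
  rw [hS.mk_mem_obstacle]
  rintro ⟨v, -, hv⟩
  exact hp v hv

theorem IsNonsingular.add {p : V} (hp : IsNonsingular E S p) (v : E) :
    IsNonsingular E S (p + (v : V)) := fun w => by
  have := hp (v + w)
  rwa [Submodule.coe_add, ← add_assoc] at this

theorem IsAtomicSurface.isNonsingular_add (hS : IsAtomicSurface L E S) {p l : V}
    (hp : IsNonsingular E S p) (hl : l ∈ L) : IsNonsingular E S (p + l) := fun v hv => by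
  have := hS.add_mem_perpBoundary (neg_mem hl) hv
  refine hp v ?_
  convert this using 1
  abel

theorem IsAtomicSurface.pattern_add (hS : IsAtomicSurface L E S) {p l : V} (hl : l ∈ L) :
    pattern E S (p + l) = pattern E S p := by
  ext v
  change p + l + (v : V) ∈ S ↔ p + (v : V) ∈ S
  rw [add_right_comm]
  exact hS.add_mem_iff hl _

variable [FiniteDimensional ℝ V] [DiscreteTopology L]

/-- Non-singular points are dense in the complement of the obstacles for the inner metric. -/
theorem IsAtomicSurface.exists_isNonsingular_near (hS : IsAtomicSurface L E S)
    (hν : ∀ v, ν v = 0 → v = 0) {p : V}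
    (hp : (Submodule.Quotient.mk p : V ⧸ L) ∉ obstacle L E S ν r) {ε : ℝ≥0∞} (hε : 0 < ε) :
    ∃ q, IsNonsingular E S q ∧
      innerEDist (obstacle L E S ν r) (Submodule.Quotient.mk p) (Submodule.Quotient.mk q) < ε := by
  obtain ⟨C, hC⟩ := hS.exists_isBoundaryCover
  have hK : IsCompact ((fun v : E => (v : V)) '' {v | ν v ≤ r}) :=
    (isCompact_seminorm_le ν hν r).image continuous_subtype_val
  -- The preimage of the obstacle in `V` is closed plus compact, so short straight segments from `p`
  -- avoid it.
  have hcl : IsClosed (perpBoundary E S + (fun v : E => (v : V)) '' {v | ν v ≤ r}) :=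
    hS.isLocallyFlat.isClosed_perpBoundary.add_right_of_isCompact hK
  have hiff : ∀ p : V, (Submodule.Quotient.mk p : V ⧸ L) ∈ obstacle L E S ν r ↔
      p ∈ perpBoundary E S + (fun v : E => (v : V)) '' {v | ν v ≤ r} := by
    intro p
    rw [hS.mk_mem_obstacle, Set.mem_add]
    constructor
    · rintro ⟨v, hv, hpv⟩
      exact ⟨_, hpv, _, ⟨-v, by rwa [mem_ofPred_eq, map_neg_eq_map], rfl⟩, by simp⟩
    · rintro ⟨x, hx, _, ⟨v, hv, rfl⟩, rfl⟩
      exact ⟨-v, by rwa [map_neg_eq_map], by simpa using hx⟩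
  rw [hiff] at hp
  obtain ⟨η, hη, hball⟩ := Metric.isOpen_iff.1 hcl.isOpen_compl p hp
  obtain ⟨ε', hε', hεε⟩ := ENNReal.lt_iff_exists_real_btwn.1 hε
  have hε0 : 0 < ε' := ENNReal.ofReal_pos.1 hεε.1
  obtain ⟨q, hq, hqp⟩ := Metric.dense_iff.1 hC.dense_isNonsingular p _ (lt_min hη hε0)
  rw [Metric.mem_ball, dist_eq_norm] at hq
  refine ⟨q, hqp, ?_⟩
  have := innerEDist_segment_le (Y := obstacle L E S ν r) p (q - p) fun t ht => by
    rw [hiff]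
    refine hball ?_
    rw [Metric.mem_ball, dist_eq_norm, add_sub_cancel_left, norm_smul, Real.norm_of_nonneg ht.1]
    exact (mul_le_of_le_one_left (norm_nonneg _) ht.2).trans_lt (hq.trans_le (min_le_left _ _))
  rw [add_sub_cancel] at this
  refine this.trans_lt (lt_of_le_of_lt (ENNReal.ofReal_le_ofReal ?_) hεε.2)
  exact hq.le.trans (min_le_right _ _)

theorem norm_along_le (w : V) : ‖along E w‖ ≤ 2 * ‖w‖ := by
  change ‖w - Eᗮ.starProjection w‖ ≤ _
  have := norm_sub_le w (Eᗮ.starProjection w)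
  have := Eᗮ.norm_starProjection_apply_le w
  linarith

/-- Along a short path that avoids the obstacles, the points of the pattern move by small vectors. -/
theorem IsAtomicSurface.exists_near_of_innerEDist_lt (hS : IsAtomicSurface L E S) {δ η ρ : ℝ}
    (hδ : ∀ l ∈ L, ‖l‖ < δ → l = 0) (hη : 0 < η) (hηδ : 4 * η ≤ δ)
    (hr : ∀ v : E, ‖v‖ ≤ ρ + 2 * η → ν v ≤ r) {x y : V}
    (h : innerEDist (obstacle L E S ν r) (Submodule.Quotient.mk x) (Submodule.Quotient.mk y) <
      ENNReal.ofReal η) :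
    ∀ v ∈ pattern E S x, ‖v‖ ≤ ρ → ∃ v' ∈ pattern E S y, ‖v' - v‖ ≤ 2 * η := by
  intro v hv hvρ
  simp only [innerEDist, iInf_lt_iff] at h
  obtain ⟨γ, a, b, ⟨hab, hγ, ha, hb, hY⟩, hvar⟩ := h
  have hlt : ∀ t ∈ Icc a b, ‖γ t - Submodule.Quotient.mk x‖ < η := by
    intro t ht
    have := (eVariationOn.edist_le γ ht (left_mem_Icc.2 hab)).trans_lt hvar
    rwa [ha, edist_dist, ENNReal.ofReal_lt_ofReal_iff hη, dist_eq_norm] at this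
  obtain ⟨c, hc, hca, hcγ⟩ := exists_lift hδ hη hηδ hab hγ ha hlt
  -- The pattern point follows only the `Eᗮ` component of the path. It thereby stays in one flat and
  -- in the moving cut, where its position is `v` minus the `E` component.
  let A : Set V := (fun t => x + v + Eᗮ.starProjection (c t - x)) '' Icc a b
  have hA : IsPreconnected A := by
    refine isPreconnected_Icc.image _ (continuousOn_const.add ?_)
    exact (Eᗮ.starProjection).continuous.comp_continuousOn (hc.sub continuousOn_const)
  have hal : ∀ t ∈ Icc a b, ‖along E (c t - x)‖ ≤ 2 * η := fun t ht =>
    (norm_along_le _).trans (by linarith [(hcγ t ht).2])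
  have hmove : ∀ t, x + v + Eᗮ.starProjection (c t - x) = c t + ((v - along E (c t - x) : E) : V) := by
    intro t
    rw [eq_sub_of_add_eq (add_along (E := E) (c t - x)), Submodule.coe_sub]
    abel
  have hsub : A ⊆ S := by
    refine subset_of_isPreconnected (E := E) hS.isLocallyFlat.isClosed hA ?_ ?_ ?_
    · rintro _ ⟨s, -, rfl⟩ _ ⟨t, -, rfl⟩
      simp only [add_sub_add_left_eq_sub]
      exact sub_mem (Eᗮ.starProjection_apply_mem _) (Eᗮ.starProjection_apply_mem _)
    · rintro _ ⟨t, ht, rfl⟩ hB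
      refine hY t ht ?_
      rw [← (hcγ t ht).1, hS.mk_mem_obstacle]
      refine ⟨v - along E (c t - x), hr _ ?_, by rwa [← hmove]⟩
      exact (norm_sub_le _ _).trans (add_le_add hvρ (hal t ht))
    · refine ⟨_, ⟨a, left_mem_Icc.2 hab, rfl⟩, ?_⟩
      simp only [hca, sub_self, map_zero, add_zero]
      exact hv
  have hbI : b ∈ Icc a b := right_mem_Icc.2 hab
  have hmem := hsub ⟨b, hbI, rfl⟩
  simp only [hmove] at hmem
  have hl : y - c b ∈ L := by
    rw [← Submodule.Quotient.eq L, (hcγ b hbI).1, hb]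
  refine ⟨v - along E (c b - x), ?_, ?_⟩
  · have := (hS.pattern_add (p := c b) hl).symm ▸ (show v - along E (c b - x) ∈ pattern E S (c b) from hmem)
    rwa [add_sub_cancel] at this
  · rw [sub_sub_cancel_left, norm_neg]
    exact hal b hbI

end Obstacles

/-! ### Comparison of the two uniformities -/

section Uniformities

variable {V : Type*} [NormedAddCommGroup V] [InnerProductSpace ℝ V] {L : Submodule ℤ V}
  {E : Submodule ℝ V} {S : Set V} {ν : Seminorm ℝ E} [FiniteDimensional ℝ V] [DiscreteTopology L]

/-- Transport along a short path matches patches of radius `ρ = 1 / ε'` with error `2 * η < 1 / ρ`,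
provided that `r n` dominates `ν` on the Euclidean ball of radius `ρ + 2 * η`. -/
theorem IsAtomicSurface.exists_matchEDist_lt (hS : IsAtomicSurface L E S) {r : ℕ → ℝ}
    (hr : ¬ BddAbove (range r)) {ε : ℝ≥0∞} (hε : 0 < ε) :
    ∃ n, ∃ η : ℝ≥0∞, 0 < η ∧ ∀ x y : V, innerEDist (obstacle L E S ν (r n))
      (Submodule.Quotient.mk x) (Submodule.Quotient.mk y) < η →
      matchEDist (pattern E S x) (pattern E S y) < ε := by
  obtain ⟨ε', hε', hεε⟩ := ENNReal.lt_iff_exists_real_btwn.1 hε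
  have hε0 : 0 < ε' := ENNReal.ofReal_pos.1 hεε.1
  obtain ⟨δ, hδ0, hδ⟩ := exists_forall_lattice_eq_zero L
  obtain ⟨C, hC, hCν⟩ := exists_seminorm_le ν
  let ρ : ℝ := 1 / ε'
  have hρ : 0 < ρ := by positivity
  let η : ℝ := min (δ / 4) (1 / (4 * ρ))
  have hη : 0 < η := lt_min (by positivity) (by positivity)
  obtain ⟨n, hn⟩ : ∃ n, C * (ρ + 2 * η) ≤ r n := by
    by_contra! hcon
    exact hr ⟨_, by rintro _ ⟨n, rfl⟩; exact (hcon n).le⟩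
  refine ⟨n, ENNReal.ofReal η, ENNReal.ofReal_pos.2 hη, fun x y hxy => ?_⟩
  have h4 : 4 * η ≤ δ := by linarith [min_le_left (δ / 4) (1 / (4 * ρ))]
  have hrn : ∀ v : E, ‖v‖ ≤ ρ + 2 * η → ν v ≤ r n := fun v hv =>
    (hCν v).trans ((mul_le_mul_of_nonneg_left hv hC).trans hn)
  have hH := hausdorffEDist_patch_le (hS.exists_near_of_innerEDist_lt hδ hη h4 hrn hxy)
    (hS.exists_near_of_innerEDist_lt hδ hη h4 hrn ((innerEDist_comm_le _ _ _).trans_lt hxy))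
  have hlt : 2 * η < 1 / ρ := by
    have h1 : η ≤ 1 / (4 * ρ) := min_le_right _ _
    have h2 : 1 / (4 * ρ) = 1 / ρ / 4 := by field_simp
    have : 0 < 1 / ρ := by positivity
    linarith
  have hm : matchEDist (pattern E S x) (pattern E S y) ≤ ENNReal.ofReal (1 / (ρ + 1)) :=
    iInf₂_le ρ ⟨hρ, hH.trans_lt ((ENNReal.ofReal_lt_ofReal_iff (by positivity)).2 hlt)⟩
  refine hm.trans_lt (lt_of_le_of_lt (ENNReal.ofReal_le_ofReal ?_) hεε.2)
  have : ε' = 1 / ρ := by simp [ρ]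
  rw [this]
  exact one_div_le_one_div_of_le hρ (by linarith)

/-- Subtracting the integer part in a lattice basis leaves a point of a bounded fundamental domain.
-/
theorem exists_lattice_norm_sub_le (L : Submodule ℤ V) [DiscreteTopology L] [IsZLattice ℝ L] :
    ∃ R : ℝ, ∀ x : V, ∃ l ∈ L, ‖x + l‖ ≤ R := by
  have : Module.Free ℤ L := ZLattice.module_free ℝ L
  have : Module.Finite ℤ L := ZLattice.module_finite ℝ L
  let b := (Module.Free.chooseBasis ℤ L).ofZLatticeBasis ℝ L
  refine ⟨∑ i, ‖b i‖, fun x => ⟨-(ZSpan.floor b x : V), neg_mem ?_, ?_⟩⟩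
  · exact (Module.Basis.ofZLatticeBasis_span ℝ L _).le (ZSpan.floor b x).2
  · rw [← sub_eq_add_neg]
    exact ZSpan.norm_fract_le (K := ℝ) b x

/-- By compactness of the torus, a failure gives two sequences with a common limit after lattice
translations, which change neither patterns nor classes. The two-piece path along `Eᗮ` and then `E`
avoids the obstacle and its length tends to 0. -/
theorem IsAtomicSurface.exists_innerEDist_lt [IsZLattice ℝ L] (hS : IsAtomicSurface L E S)
    (hE : IsTotallyIrrational L E) (hF : FacesAreCrossed E S) (hν : ∀ v, ν v = 0 → v = 0) (r : ℝ)
    {ε : ℝ≥0∞} (hε : 0 < ε) :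
    ∃ η : ℝ≥0∞, 0 < η ∧ ∀ x y : V, IsNonsingular E S x → IsNonsingular E S y →
      matchEDist (pattern E S x) (pattern E S y) < η → innerEDist (obstacle L E S ν r)
        (Submodule.Quotient.mk x) (Submodule.Quotient.mk y) < ε := by
  by_contra! hcon
  obtain ⟨R, hR⟩ := exists_lattice_norm_sub_le L
  have hpos : ∀ n : ℕ, (0 : ℝ) < 1 / ((n : ℝ) + 1) := fun n => by positivity
  have hex : ∀ n : ℕ, ∃ (x y : V) (ρ : ℝ), IsNonsingular E S x ∧ IsNonsingular E S y ∧
      ‖x‖ ≤ R ∧ ‖y‖ ≤ R ∧ (n : ℝ) ≤ ρ ∧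
      Metric.hausdorffEDist (patch (pattern E S x) ρ) (patch (pattern E S y) ρ) <
        ENNReal.ofReal (1 / ρ) ∧
      ε ≤ innerEDist (obstacle L E S ν r) (Submodule.Quotient.mk x) (Submodule.Quotient.mk y) := by
    intro n
    obtain ⟨x, y, hx, hy, hm, hle⟩ := hcon _ (ENNReal.ofReal_pos.2 (hpos n))
    obtain ⟨l, hl, hlR⟩ := hR x
    obtain ⟨l', hl', hlR'⟩ := hR y
    simp only [matchEDist, iInf_lt_iff] at hm
    obtain ⟨ρ, ⟨hρ, hH⟩, hlt⟩ := hm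
    rw [ENNReal.ofReal_lt_ofReal_iff (hpos n), one_div_lt_one_div (by positivity) (by positivity)] at hlt
    refine ⟨x + l, y + l', ρ, hS.isNonsingular_add hx hl, hS.isNonsingular_add hy hl', hlR, hlR',
      by linarith, ?_, ?_⟩
    · rwa [hS.pattern_add hl, hS.pattern_add hl']
    · rw [(Submodule.Quotient.eq L).2 (show x + l - x ∈ L by simpa using hl),
        (Submodule.Quotient.eq L).2 (show y + l' - y ∈ L by simpa using hl')]
      exact hle
  choose x y ρ hx hy hxR hyR hρ hH hle using hex
  let 𝒰 := hyperfilter ℕ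
  have hmatch : AsymptoticMatch E S (𝒰 : Filter ℕ) x y ρ :=
    ⟨(tendsto_atTop_mono hρ tendsto_natCast_atTop_atTop).mono_left Nat.hyperfilter_le_atTop, hH⟩
  have hlim : ∀ z : ℕ → V, (∀ n, ‖z n‖ ≤ R) → ∃ z₀, Tendsto z 𝒰 (𝓝 z₀) := by
    intro z hz
    obtain ⟨z₀, -, h⟩ := (isCompact_closedBall (0 : V) R).ultrafilter_le_nhds' (𝒰.map z) (by
      rw [Ultrafilter.mem_map]
      exact univ_mem' fun n => by simpa using hz n)
    exact ⟨z₀, h⟩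
  obtain ⟨x₀, hx₀⟩ := hlim x hxR
  obtain ⟨y₀, hy₀⟩ := hlim y hyR
  have hl : y₀ - x₀ ∈ L := hmatch.sub_mem_lattice hE hS hx₀ hy₀
  have hl' : x₀ - y₀ ∈ L := by
    rw [← neg_sub]
    exact neg_mem hl
  let y' : ℕ → V := fun n => y n + (x₀ - y₀)
  have hy' : Tendsto y' 𝒰 (𝓝 x₀) := by
    have := hy₀.add_const (x₀ - y₀)
    rwa [add_sub_cancel] at this
  have hmatch' : AsymptoticMatch E S (𝒰 : Filter ℕ) x y' ρ :=
    ⟨hmatch.radius, fun n => by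
      simp only [y']
      rw [hS.pattern_add hl']
      exact hH n⟩
  obtain ⟨C, hC, hCν⟩ := exists_norm_le_seminorm ν hν
  have hseg := hmatch'.eventually_notMem_perpBoundary hS hF hx
    (fun n => hS.isNonsingular_add (hy n) hl') hx₀ hy' (C * r)
  have hyx : Tendsto (fun n => y' n - x n) 𝒰 (𝓝 0) := by simpa using hy'.sub hx₀
  have hlen : Tendsto (fun n => ENNReal.ofReal ‖Eᗮ.starProjection (y' n - x n)‖ +
      ENNReal.ofReal ‖(along E (y' n - x n) : V)‖) 𝒰 (𝓝 0) := by
    have hcont : Continuous fun w : V => ENNReal.ofReal ‖Eᗮ.starProjection w‖ +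
        ENNReal.ofReal ‖(along E w : V)‖ := by
      refine (ENNReal.continuous_ofReal.comp (Eᗮ.starProjection).continuous.norm).add
        (ENNReal.continuous_ofReal.comp ?_)
      exact (continuous_subtype_val.comp continuous_along).norm
    have := hcont.tendsto 0
    simp only [map_zero, along_zero, Submodule.coe_zero, norm_zero, ENNReal.ofReal_zero,
      add_zero] at this
    exact this.comp hyx
  obtain ⟨n, hn, hnε⟩ := (hseg.and (hlen.eventually (gt_mem_nhds hε))).exists
  refine (hle n).not_gt (lt_of_le_of_lt ?_ hnε)
  have hymk : (Submodule.Quotient.mk (y n) : V ⧸ L) = Submodule.Quotient.mk (y' n) := by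
    rw [Submodule.Quotient.eq]
    simpa [y'] using hl
  have hyn : y' n = x n + Eᗮ.starProjection (y' n - x n) + (along E (y' n - x n) : V) := by
    rw [add_assoc, add_along, add_sub_cancel]
  have hy'n : IsNonsingular E S (y' n) := hS.isNonsingular_add (hy n) hl'
  rw [hymk]
  refine (innerEDist_triangle _ _
    (Submodule.Quotient.mk (x n + Eᗮ.starProjection (y' n - x n))) _).trans (add_le_add ?_ ?_)
  · refine innerEDist_segment_le _ _ fun t ht => ?_
    rw [hS.mk_mem_obstacle]
    rintro ⟨v, hv, hB⟩
    exact hn t ht v ((hCν v).trans (mul_le_mul_of_nonneg_left hv hC)) hB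
  · generalize along E (y' n - x n) = a at hyn ⊢
    generalize x n + Eᗮ.starProjection (y' n - x n) = p at hyn ⊢
    rw [hyn] at hy'n ⊢
    refine innerEDist_segment_le _ _ fun t _ => hS.mk_notMem_obstacle ?_
    have h1 : p + t • (a : V) = p + (a : V) + (((t - 1) • a : E) : V) := by
      rw [Submodule.coe_smul, sub_smul, one_smul]
      abel
    rw [h1]
    exact hy'n.add _

end Uniformities

/-! ### The two completions -/

section Completions

/-- Two dense maps to complete separated uniform spaces that induce the same uniformity have
homeomorphic codomains. -/
theorem nonempty_homeomorph_of_comap_uniformity_eq {N A B : Type*} [UniformSpace A] [UniformSpace B]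
    [CompleteSpace A] [CompleteSpace B] [T0Space A] [T0Space B] {i : N → A} {j : N → B}
    (hi : DenseRange i) (hj : DenseRange j)
    (h : comap (Prod.map i i) (uniformity A) = comap (Prod.map j j) (uniformity B)) :
    Nonempty (A ≃ₜ B) := by
  -- This uniformity need not be separated, since `i` need not be injective; both codomains are
  -- still completions of it.
  let _ : UniformSpace N := UniformSpace.comap i inferInstance
  let pA : AbstractCompletion N :=
    { space := A, coe := i, uniformStruct := inferInstance, complete := inferInstance,
      separation := inferInstance, isUniformInducing := ⟨rfl⟩, dense := hi }
  let pB : AbstractCompletion N :=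
    { space := B, coe := j, uniformStruct := inferInstance, complete := inferInstance,
      separation := inferInstance, isUniformInducing := ⟨h.symm⟩, dense := hj }
  exact ⟨(AbstractCompletion.compareEquiv pA pB).toHomeomorph⟩

theorem comap_completion_coe_uniformity {N A : Type*} [PseudoEMetricSpace A] (f : N → A) :
    comap (fun p : N × N => ((f p.1 : UniformSpace.Completion A), (f p.2 : UniformSpace.Completion A)))
      (uniformity (UniformSpace.Completion A)) = ⨅ ε > 0, 𝓟 {p | edist (f p.1) (f p.2) < ε} := by
  have h := (UniformSpace.Completion.isUniformInducing_coe A).comap_uniformity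
  have h1 : (fun p : N × N => ((f p.1 : UniformSpace.Completion A), (f p.2 : UniformSpace.Completion A)))
      = (fun x : A × A => ((x.1 : UniformSpace.Completion A), (x.2 : UniformSpace.Completion A))) ∘
        Prod.map f f := rfl
  rw [h1, ← comap_comap, h, PseudoEMetricSpace.uniformity_edist]
  simp only [comap_iInf, comap_principal]
  rfl

variable {V : Type*} [NormedAddCommGroup V] [InnerProductSpace ℝ V] {L : Submodule ℤ V}
  {E : Submodule ℝ V} {S : Set V} {ν : Seminorm ℝ E}

theorem continuous_transition {r s : ℝ} (h : r ≤ s) : Continuous (transition L E S ν h) :=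
  UniformSpace.Completion.continuous_map

theorem transition_coe {r s : ℝ} (h : r ≤ s) (z : Complement (obstacle L E S ν s)) :
    transition L E S ν h z = (Complement.incl (obstacle_mono L E S ν h) z :
      CompletedComplement L E S ν r) :=
  UniformSpace.Completion.map_coe (Complement.lipschitz_incl _).uniformContinuous z

instance {r : ℕ → ℝ} (hr : Monotone r) : CompleteSpace (InverseLimit L E S ν hr) := by
  refine IsClosed.completeSpace_coe (hs := ?_)
  have : {x : ∀ n, CompletedComplement L E S ν (r n) |
      ∀ n, transition L E S ν (hr n.le_succ) (x (n + 1)) = x n} =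
      ⋂ n, {x | transition L E S ν (hr n.le_succ) (x (n + 1)) = x n} := by
    ext x
    simp
  change IsClosed {x : ∀ n, CompletedComplement L E S ν (r n) |
      ∀ n, transition L E S ν (hr n.le_succ) (x (n + 1)) = x n}
  rw [this]
  exact isClosed_iInter fun n => isClosed_eq
    ((continuous_transition _).comp (continuous_apply (n + 1))) (continuous_apply n)

/-- A coordinate of a point of the inverse limit is a continuous function of each later one. -/
theorem exists_continuous_coord {r : ℕ → ℝ} (hr : Monotone r) {n m : ℕ} (h : n ≤ m) :
    ∃ f : CompletedComplement L E S ν (r m) → CompletedComplement L E S ν (r n), Continuous f ∧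
      ∀ x : InverseLimit L E S ν hr, f (x.1 m) = x.1 n := by
  induction m, h using Nat.le_induction with
  | base => exact ⟨id, continuous_id, fun _ => rfl⟩
  | succ m _ ih =>
    obtain ⟨f, hf, hfx⟩ := ih
    refine ⟨f ∘ transition L E S ν (hr m.le_succ), hf.comp (continuous_transition _), fun x => ?_⟩
    rw [Function.comp_apply, x.2 m, hfx]

/-- The non-singular points as points of the complement of the obstacles. -/
def toComplement (hS : IsAtomicSurface L E S) (r : ℝ) (x : {x : V // IsNonsingular E S x}) :
    Complement (obstacle L E S ν r) :=
  ⟨Submodule.Quotient.mk x.1, hS.mk_notMem_obstacle x.2⟩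

/-- The non-singular points as points of the inverse limit. -/
def toInverseLimit (hS : IsAtomicSurface L E S) {r : ℕ → ℝ} (hr : Monotone r)
    (x : {x : V // IsNonsingular E S x}) : InverseLimit L E S ν hr :=
  ⟨fun n => (toComplement hS (r n) x : Complement (obstacle L E S ν (r n))),
    fun _ => transition_coe _ _⟩

/-- The pattern produced by the cut through a non-singular point. -/
def toPattern (E : Submodule ℝ V) (S : Set V) (x : {x : V // IsNonsingular E S x}) : Pattern E S :=
  ⟨pattern E S x.1, x.1, x.2, rfl⟩

/-- The non-singular points as points of the hull. -/
def toHull (E : Submodule ℝ V) (S : Set V) (x : {x : V // IsNonsingular E S x}) : Hull E S :=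
  UniformSpace.Completion.coe' (toPattern E S x)

theorem denseRange_toHull : DenseRange (toHull E S) := by
  have hs : Function.Surjective (toPattern E S) := by
    rintro ⟨_, x, hx, rfl⟩
    exact ⟨⟨x, hx⟩, rfl⟩
  exact UniformSpace.Completion.denseRange_coe.comp hs.denseRange
    (UniformSpace.Completion.continuous_coe _)

theorem comap_toHull : comap (Prod.map (toHull E S) (toHull E S)) (uniformity (Hull E S)) =
    ⨅ ε > 0, 𝓟 {p | matchEDist (pattern E S p.1.1) (pattern E S p.2.1) < ε} :=
  comap_completion_coe_uniformity (toPattern E S)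

theorem comap_toInverseLimit (hS : IsAtomicSurface L E S) {r : ℕ → ℝ} (hr : Monotone r) :
    comap (Prod.map (toInverseLimit (ν := ν) hS hr) (toInverseLimit hS hr))
      (uniformity (InverseLimit L E S ν hr)) =
    ⨅ n, ⨅ ε > 0, 𝓟 {p | innerEDist (obstacle L E S ν (r n)) (Submodule.Quotient.mk p.1.1)
      (Submodule.Quotient.mk p.2.1) < ε} := by
  rw [uniformity_subtype, Pi.uniformity, comap_iInf, comap_iInf]
  refine iInf_congr fun n => ?_
  rw [comap_comap, comap_comap]
  exact comap_completion_coe_uniformity (toComplement hS (r n))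

variable [FiniteDimensional ℝ V] [DiscreteTopology L]

theorem denseRange_toComplement (hS : IsAtomicSurface L E S) (hν : ∀ v, ν v = 0 → v = 0) (r : ℝ) :
    DenseRange (toComplement (ν := ν) hS r) := by
  intro z
  obtain ⟨p, hp⟩ := Submodule.Quotient.mk_surjective L z.1
  refine EMetric.mem_closure_iff.2 fun ε hε => ?_
  obtain ⟨q, hq, hlt⟩ := hS.exists_isNonsingular_near hν (hp ▸ z.2) hε
  rw [hp] at hlt
  exact ⟨_, ⟨⟨q, hq⟩, rfl⟩, hlt⟩

theorem denseRange_toInverseLimit (hS : IsAtomicSurface L E S) (hν : ∀ v, ν v = 0 → v = 0)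
    {r : ℕ → ℝ} (hr : Monotone r) : DenseRange (toInverseLimit (ν := ν) hS hr) := by
  intro x
  rw [mem_closure_iff]
  intro U hU hxU
  obtain ⟨U', hU', rfl⟩ := isOpen_induced_iff.1 hU
  obtain ⟨I, u, hu, hIu⟩ := isOpen_pi_iff.1 hU' x.1 hxU
  -- The finitely many coordinates that matter are continuous functions of the `m`-th one, so
  -- density in a single complement suffices.
  let m := I.sup id
  have hle : ∀ n : I, n.1 ≤ m := fun n => Finset.le_sup (f := id) n.2
  choose f hf hfx using fun n : I =>
    exists_continuous_coord (L := L) (E := E) (S := S) (ν := ν) hr (hle n)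
  let W : Set (CompletedComplement L E S ν (r m)) := ⋂ n : I, f n ⁻¹' u n
  have hW : IsOpen W := isOpen_iInter_of_finite fun n => (hu n n.2).1.preimage (hf n)
  have hxW : x.1 m ∈ W := mem_iInter.2 fun n => by
    rw [mem_preimage, hfx n]
    exact (hu n n.2).2
  have hd : DenseRange fun y => ((toComplement hS (r m) y : Complement (obstacle L E S ν (r m))) :
      CompletedComplement L E S ν (r m)) :=
    UniformSpace.Completion.denseRange_coe.comp (denseRange_toComplement hS hν (r m))
      (UniformSpace.Completion.continuous_coe _)
  obtain ⟨y, hy⟩ := hd.exists_mem_open hW ⟨_, hxW⟩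
  refine ⟨toInverseLimit hS hr y, hIu fun n hn => ?_, y, rfl⟩
  have := mem_iInter.1 hy ⟨n, hn⟩
  have hfy := hfx ⟨n, hn⟩ (toInverseLimit hS hr y)
  exact hfy ▸ this

end Completions

end CutProject

end

theorem corollary1 {V : Type*} [NormedAddCommGroup V] [InnerProductSpace ℝ V]
    [FiniteDimensional ℝ V] (L : Submodule ℤ V) [DiscreteTopology L] [IsZLattice ℝ L]
    (E : Submodule ℝ V) (hE : CutProject.IsTotallyIrrational L E)
    (S : Set V) (hS : CutProject.IsAtomicSurface L E S) (hF : CutProject.FacesAreCrossed E S)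
    (ν : Seminorm ℝ E) (hν : ∀ v : E, ν v = 0 → v = 0)
    (r : ℕ → ℝ) (hr : Monotone r) (hr' : ¬ BddAbove (Set.range r)) :
    Nonempty (CutProject.InverseLimit L E S ν hr ≃ₜ CutProject.Hull E S) := by
  refine CutProject.nonempty_homeomorph_of_comap_uniformity_eq
    (CutProject.denseRange_toInverseLimit hS hν hr) CutProject.denseRange_toHull ?_
  rw [CutProject.comap_toInverseLimit, CutProject.comap_toHull]
  refine le_antisymm (le_iInf₂ fun ε hε => ?_) (le_iInf fun n => le_iInf₂ fun ε hε => ?_)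
  · obtain ⟨n, η, hη, h⟩ := hS.exists_matchEDist_lt (ν := ν) hr' hε
    refine (iInf_le _ n).trans ((iInf₂_le η hη).trans (principal_mono.2 ?_))
    exact fun p hp => h _ _ hp
  · obtain ⟨η, hη, h⟩ := hS.exists_innerEDist_lt hE hF hν (r n) hε
    refine (iInf₂_le η hη).trans (principal_mono.2 ?_)
    exact fun p hp => h _ _ p.1.2 p.2.2 hp
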